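/- Let $X$ be a completely regular Hausdorff space and let $C(X)$ be the ring of all continuous real-valued functions on $X$. Let $Q(X)$ denote the maximal ring of quotients of $C(X)$, that is, $Q(X)=\varinjlim_D \operatorname{Hom}_{C(X)}(D,C(X))$, where $D$ runs over the ideals of $C(X)$ whose only annihilator in $C(X)$ is $0$, homomorphisms are identified when they agree on the common part of their domains, and multiplication is composition. As a $C(X)$-algebra, $Q(X)$ is isomorphic to the ring $\varinjlim_V C(V)$ of all continuous real-valued functions on the dense open subsets $V$ of $X$ (two functions being identified when they agree on the common part of their domains); identify $Q(X)$ with this ring, let $Q^*(X)$ be its subring of bounded functions, and give $Q(X)$ the metric $(f,g)\mapsto \sup_x \frac{|f(x)-g(x)|}{1+|f(x)-g(x)|}$. Let $\overline{Q}(X)$ be the metric completion of $Q(X)$, realized as the ring of all continuous real-valued functions on the dense $G_\delta$ subsets of the Stone-Čech compactification $\beta X$ (with the analogous identification and metric): this ring is metrically complete, and there is an isometric ring homomorphism of $Q(X)$ onto a dense subring of it. Let $\overline{Q}^*(X)$ be the subring of bounded functions in $\overline{Q}(X)$. Let $E(Q(X))$ be the Boolean ring of all idempotents of $Q(X)$,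 with the multiplication of $Q(X)$ and the addition $(e,f)\mapsto e+f-2ef$. Then the maximal ideal spaces (the sets of maximal ideals with the topology having as a base the sets $\{M : a\notin M\}$, $a$ in the ring) of $Q(X)$, $Q^*(X)$, $\overline{Q}(X)$, $\overline{Q}^*(X)$ and $E(Q(X))$ are all homeomorphic. -/

import Mathlib

open Set Topology

noncomputable section

namespace RingsOfQuotients

universe u

/-! ### The maximal ring of quotients of a commutative ring -/

section MaximalQuotients

variable {A : Type u} [CommRing A]

/-- An ideal is (rationally) dense if its only annihilator in the ring is `0`. -/
def IsDenseIdeal (D : Ideal A) : Prop :=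
  ∀ a : A, (∀ d ∈ D, a * d = 0) → a = 0

theorem isDenseIdeal_top : IsDenseIdeal (⊤ : Ideal A) := fun a h => by
  simpa using h 1 trivial

theorem IsDenseIdeal.mul {D E : Ideal A} (hD : IsDenseIdeal D) (hE : IsDenseIdeal E) :
    IsDenseIdeal (D * E) := fun a h =>
  hD a fun d hd => hE _ fun e he => by
    rw [mul_assoc]; exact h _ (Ideal.mul_mem_mul hd he)

theorem IsDenseIdeal.inf {D E : Ideal A} (hD : IsDenseIdeal D) (hE : IsDenseIdeal E) :
    IsDenseIdeal (D ⊓ E) := fun a h =>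
  hD.mul hE a fun d hd => h d (Ideal.mul_le_inf hd)

variable (A) in
/-- The elements of `Hom D = Hom_A(D, A)`, with `D` running over the dense ideals of `A`. -/
structure DenseHom where
  dom : Ideal A
  dense : IsDenseIdeal dom
  hom : dom →ₗ[A] A

namespace DenseHom

theorem hom_mul_comm (φ : DenseHom A) {x y : A} (hx : x ∈ φ.dom) (hy : y ∈ φ.dom) :
    x * φ.hom ⟨y, hy⟩ = y * φ.hom ⟨x, hx⟩ := by
  rw [← smul_eq_mul, ← smul_eq_mul, ← map_smul, ← map_smul]
  congr 1
  ext
  simp [mul_comm]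

/-- Two homomorphisms on dense ideals are identified if they agree on the common part of their
domains. -/
def Rel (φ ψ : DenseHom A) : Prop :=
  ∀ (x : A) (hx : x ∈ φ.dom) (hx' : x ∈ ψ.dom), φ.hom ⟨x, hx⟩ = ψ.hom ⟨x, hx'⟩

/-- It suffices that they agree on a set with zero annihilator. -/
theorem Rel.of_set {φ ψ : DenseHom A} (s : Set A) (hs : ∀ a : A, (∀ x ∈ s, a * x = 0) → a = 0)
    (h : ∀ x ∈ s, ∃ (hx : x ∈ φ.dom) (hx' : x ∈ ψ.dom), φ.hom ⟨x, hx⟩ = ψ.hom ⟨x, hx'⟩) :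
    Rel φ ψ := fun y hy hy' => by
  refine sub_eq_zero.mp (hs _ fun x hx => ?_)
  obtain ⟨h1, h2, h3⟩ := h x hx
  rw [sub_mul, mul_comm, φ.hom_mul_comm h1 hy, h3, mul_comm (ψ.hom _), ψ.hom_mul_comm h2 hy',
    sub_self]

variable (A) in
instance setoid : Setoid (DenseHom A) where
  r := Rel
  iseqv :=
    { refl := fun _ _ _ _ => rfl
      symm := fun h x hx hx' => (h x hx' hx).symm
      trans := fun {φ ψ χ} h h' =>
        Rel.of_set ((φ.dom ⊓ ψ.dom ⊓ χ.dom : Ideal A) : Set A)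
          ((φ.dense.inf ψ.dense).inf χ.dense) fun x hx =>
          ⟨hx.1.1, hx.2, (h x hx.1.1 hx.1.2).trans (h' x hx.1.2 hx.2)⟩ }

/-- An element `a` of `A`, regarded as the mapping `x ↦ a * x` on `A`. -/
def ofElem (a : A) : DenseHom A where
  dom := ⊤
  dense := isDenseIdeal_top
  hom := a • Submodule.subtype _

/-- The sum, defined on the intersection of the domains. -/
def add (φ ψ : DenseHom A) : DenseHom A where
  dom := φ.dom ⊓ ψ.dom
  dense := φ.dense.inf ψ.dense
  hom := φ.hom ∘ₗ Submodule.inclusion inf_le_left + ψ.hom ∘ₗ Submodule.inclusion inf_le_right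

/-- The negative. -/
def neg (φ : DenseHom A) : DenseHom A where
  dom := φ.dom
  dense := φ.dense
  hom := -φ.hom

theorem hom_mem_of_mem_mul (φ : DenseHom A) {D : Ideal A} {x : A} (hx : x ∈ D * φ.dom)
    (hx' : x ∈ φ.dom) : φ.hom ⟨x, hx'⟩ ∈ D := by
  have key : ∃ h : x ∈ φ.dom, φ.hom ⟨x, h⟩ ∈ D := by
    induction hx using Submodule.mul_induction_on' with
    | mem_mul_mem d hd e he =>
      refine ⟨φ.dom.mul_mem_left d he, ?_⟩
      have h : φ.hom (d • ⟨e, he⟩) = d * φ.hom ⟨e, he⟩ := φ.hom.map_smul d ⟨e, he⟩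
      exact h ▸ D.mul_mem_right _ hd
    | add x hx y hy h1 h2 =>
      obtain ⟨h1, h1'⟩ := h1
        (Ideal.mul_le_right hx)
      obtain ⟨h2, h2'⟩ := h2
        (Ideal.mul_le_right hy)
      refine ⟨φ.dom.add_mem h1 h2, ?_⟩
      have h : φ.hom (⟨x, h1⟩ + ⟨y, h2⟩) = φ.hom ⟨x, h1⟩ + φ.hom ⟨y, h2⟩ := φ.hom.map_add _ _
      exact h ▸ D.add_mem h1' h2'
  exact key.2

/-- The product is the composition `φ ∘ ψ`, defined on the product of the domains. -/
def mul (φ ψ : DenseHom A) : DenseHom A where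
  dom := φ.dom * ψ.dom
  dense := φ.dense.mul ψ.dense
  hom := φ.hom ∘ₗ LinearMap.codRestrict φ.dom (ψ.hom ∘ₗ Submodule.inclusion Ideal.mul_le_right)
    fun x => ψ.hom_mem_of_mem_mul x.2 _

theorem add_hom (φ ψ : DenseHom A) {x : A} (hx : x ∈ φ.dom) (hx' : x ∈ ψ.dom) :
    (add φ ψ).hom ⟨x, hx, hx'⟩ = φ.hom ⟨x, hx⟩ + ψ.hom ⟨x, hx'⟩ := rfl

theorem mul_hom (φ ψ : DenseHom A) {d e x : A} (hd : d ∈ φ.dom) (he : e ∈ ψ.dom)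
    (hx : x = d * e) :
    ∃ h : x ∈ (mul φ ψ).dom, (mul φ ψ).hom ⟨x, h⟩ = φ.hom ⟨d, hd⟩ * ψ.hom ⟨e, he⟩ := by
  subst hx
  have h : ψ.hom ⟨d * e, ψ.dom.mul_mem_left d he⟩ = d * ψ.hom ⟨e, he⟩ :=
    ψ.hom.map_smul d ⟨e, he⟩
  have h2 : φ.hom ⟨d * ψ.hom ⟨e, he⟩, φ.dom.mul_mem_right _ hd⟩ =
      φ.hom ⟨d, hd⟩ * ψ.hom ⟨e, he⟩ := by
    rw [mul_comm (φ.hom _), ← smul_eq_mul (ψ.hom _), ← map_smul]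
    congr 1
    ext
    simp [mul_comm]
  refine ⟨Ideal.mul_mem_mul hd he, ?_⟩
  rw [← h2]
  show φ.hom _ = φ.hom _
  congr 1
  ext
  exact h

end DenseHom

variable (A) in
/-- The maximal ring of quotients `𝒬(A)` of a commutative ring: the direct limit of the modules
`Hom D` over all dense ideals `D` of `A`, with composition as multiplication. -/
def MaxQuot : Type u := Quotient (DenseHom.setoid A)

namespace MaxQuot

open DenseHom

/-- The class of a homomorphism on a dense ideal. -/
def mk (φ : DenseHom A) : MaxQuot A := Quotient.mk _ φ

theorem mk_eq_of_set {φ ψ : DenseHom A} (s : Set A)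
    (hs : ∀ a : A, (∀ x ∈ s, a * x = 0) → a = 0)
    (h : ∀ x ∈ s, ∃ (hx : x ∈ φ.dom) (hx' : x ∈ ψ.dom), φ.hom ⟨x, hx⟩ = ψ.hom ⟨x, hx'⟩) :
    mk φ = mk ψ :=
  Quotient.sound (Rel.of_set s hs h)

instance : Zero (MaxQuot A) := ⟨mk (ofElem 0)⟩
instance : One (MaxQuot A) := ⟨mk (ofElem 1)⟩

instance : Add (MaxQuot A) where
  add := Quotient.map₂ add fun _ _ h _ _ h' x hx hx' =>
    congrArg₂ (· + ·) (h x hx.1 hx'.1) (h' x hx.2 hx'.2)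

instance : Neg (MaxQuot A) where
  neg := Quotient.map neg fun _ _ h x hx hx' => congrArg (- ·) (h x hx hx')

theorem prod_set_ann {φ ψ : DenseHom A} (a : A)
    (h : ∀ x ∈ {x : A | ∃ d ∈ φ.dom, ∃ e ∈ ψ.dom, x = d * e}, a * x = 0) : a = 0 :=
  φ.dense a fun d hd => ψ.dense _ fun e he => by
    rw [mul_assoc]; exact h _ ⟨d, hd, e, he, rfl⟩

theorem mk_mul_eq {φ ψ χ : DenseHom A}
    (h : ∀ (d : A) (hd : d ∈ φ.dom) (e : A) (he : e ∈ ψ.dom), ∃ hx : d * e ∈ χ.dom,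
      χ.hom ⟨d * e, hx⟩ = φ.hom ⟨d, hd⟩ * ψ.hom ⟨e, he⟩) :
    mk (mul φ ψ) = mk χ := by
  refine mk_eq_of_set {x | ∃ d ∈ φ.dom, ∃ e ∈ ψ.dom, x = d * e} prod_set_ann ?_
  rintro _ ⟨d, hd, e, he, rfl⟩
  obtain ⟨h1, h2⟩ := mul_hom φ ψ hd he rfl
  obtain ⟨h3, h4⟩ := h d hd e he
  exact ⟨h1, h3, h2.trans h4.symm⟩

instance : Mul (MaxQuot A) where
  mul := Quotient.map₂ mul fun φ φ' h ψ ψ' h' => by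
    refine Rel.of_set {x | ∃ d ∈ (add φ φ').dom, ∃ e ∈ (add ψ ψ').dom, x = d * e}
      prod_set_ann ?_
    rintro _ ⟨d, hd, e, he, rfl⟩
    obtain ⟨h1, h2⟩ := mul_hom φ ψ hd.1 he.1 rfl
    obtain ⟨h3, h4⟩ := mul_hom φ' ψ' hd.2 he.2 rfl
    exact ⟨h1, h3, by rw [h2, h4, h d hd.1 hd.2, h' e he.1 he.2]⟩

theorem mk_add (φ ψ : DenseHom A) : mk φ + mk ψ = mk (add φ ψ) := rfl
theorem mk_mul (φ ψ : DenseHom A) : mk φ * mk ψ = mk (mul φ ψ) := rfl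
theorem mk_neg (φ : DenseHom A) : -mk φ = mk (neg φ) := rfl
theorem zero_eq_mk : (0 : MaxQuot A) = mk (ofElem 0) := rfl
theorem one_eq_mk : (1 : MaxQuot A) = mk (ofElem 1) := rfl

theorem ind {p : MaxQuot A → Prop} (h : ∀ φ, p (mk φ)) (a : MaxQuot A) : p a :=
  Quotient.ind h a

theorem mem_ofElem (a x : A) : x ∈ (ofElem a).dom := Submodule.mem_top

theorem ofElem_hom (a x : A) (hx : x ∈ (ofElem a).dom) : (ofElem a).hom ⟨x, hx⟩ = a * x := rfl

theorem mk_ofElem_mul (a : A) {φ χ : DenseHom A}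
    (h : ∀ (x : A) (hx : x ∈ φ.dom), ∃ hx' : x ∈ χ.dom, χ.hom ⟨x, hx'⟩ = a * φ.hom ⟨x, hx⟩) :
    mk (ofElem a) * mk φ = mk χ := by
  refine mk_mul_eq fun d hd e he => ?_
  obtain ⟨h1, h2⟩ := h (d * e) (φ.dom.mul_mem_left d he)
  refine ⟨h1, ?_⟩
  have h3 : φ.hom ⟨d * e, φ.dom.mul_mem_left d he⟩ = d * φ.hom ⟨e, he⟩ :=
    φ.hom.map_smul d ⟨e, he⟩
  rw [h2, h3, ofElem_hom, mul_assoc]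

protected theorem mul_comm' (a b : MaxQuot A) : a * b = b * a := by
  induction a using ind with | _ a
  induction b using ind with | _ b
  refine mk_mul_eq fun d hd e he => ?_
  rw [mul_comm (a.hom _)]
  exact mul_hom b a he hd (mul_comm d e)

protected theorem one_mul' (a : MaxQuot A) : 1 * a = a := by
  induction a using ind with | _ a
  exact mk_ofElem_mul 1 fun x hx => ⟨hx, (one_mul _).symm⟩

protected theorem zero_mul' (a : MaxQuot A) : 0 * a = 0 := by
  induction a using ind with | _ a
  exact mk_ofElem_mul 0 fun x hx => ⟨mem_ofElem 0 x, by rw [ofElem_hom, zero_mul, zero_mul]⟩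

protected theorem left_distrib' (a b c : MaxQuot A) : a * (b + c) = a * b + a * c := by
  induction a using ind with | _ a
  induction b using ind with | _ b
  induction c using ind with | _ c
  refine mk_mul_eq (φ := a) (ψ := add b c) (χ := add (mul a b) (mul a c)) fun d hd e he => ?_
  obtain ⟨h1, h2⟩ := mul_hom a b hd he.1 rfl
  obtain ⟨h3, h4⟩ := mul_hom a c hd he.2 rfl
  exact ⟨⟨h1, h3⟩, by rw [add_hom _ _ h1 h3, add_hom b c he.1 he.2, h2, h4, mul_add]⟩

protected theorem mul_assoc' (a b c : MaxQuot A) : a * b * c = a * (b * c) := by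
  induction a using ind with | _ a
  induction b using ind with | _ b
  induction c using ind with | _ c
  refine mk_eq_of_set (φ := mul (mul a b) c) (ψ := mul a (mul b c))
    {x | ∃ d ∈ a.dom, ∃ e ∈ {y : A | ∃ d ∈ b.dom, ∃ e ∈ c.dom, y = d * e}, x = d * e}
    (fun y h => a.dense y fun d hd => prod_set_ann (φ := b) (ψ := c) _ fun e he => ?_) ?_
  · rw [mul_assoc]
    exact h _ ⟨d, hd, e, he, rfl⟩
  · rintro _ ⟨x, hx, _, ⟨y, hy, z, hz, rfl⟩, rfl⟩
    obtain ⟨h1, h2⟩ := mul_hom a b hx hy rfl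
    obtain ⟨h3, h4⟩ := mul_hom b c hy hz rfl
    obtain ⟨h5, h6⟩ := mul_hom (mul a b) c h1 hz (mul_assoc x y z).symm
    obtain ⟨h7, h8⟩ := mul_hom a (mul b c) hx h3 rfl
    exact ⟨h5, h7, by rw [h6, h8, h2, h4, mul_assoc]⟩

protected theorem zero_add' (a : MaxQuot A) : 0 + a = a := by
  induction a using ind with | _ a
  refine mk_eq_of_set (φ := add (ofElem 0) a) (a.dom : Set A) a.dense fun x hx =>
    ⟨⟨mem_ofElem 0 x, hx⟩, hx, ?_⟩
  rw [add_hom _ _ (mem_ofElem 0 x) hx, ofElem_hom, zero_mul, zero_add]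

protected theorem add_comm' (a b : MaxQuot A) : a + b = b + a := by
  induction a using ind with | _ a
  induction b using ind with | _ b
  exact mk_eq_of_set (φ := add a b) (ψ := add b a) ((a.dom ⊓ b.dom : Ideal A) : Set A)
    (a.dense.inf b.dense) fun x hx =>
      ⟨hx, ⟨hx.2, hx.1⟩, add_comm (a.hom ⟨x, hx.1⟩) (b.hom ⟨x, hx.2⟩)⟩

protected theorem add_assoc' (a b c : MaxQuot A) : a + b + c = a + (b + c) := by
  induction a using ind with | _ a
  induction b using ind with | _ b
  induction c using ind with | _ c
  exact mk_eq_of_set (φ := add (add a b) c) (ψ := add a (add b c))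
    ((a.dom ⊓ b.dom ⊓ c.dom : Ideal A) : Set A)
    ((a.dense.inf b.dense).inf c.dense) fun x hx =>
      ⟨⟨⟨hx.1.1, hx.1.2⟩, hx.2⟩, ⟨hx.1.1, hx.1.2, hx.2⟩,
        add_assoc (a.hom ⟨x, hx.1.1⟩) (b.hom ⟨x, hx.1.2⟩) (c.hom ⟨x, hx.2⟩)⟩

protected theorem neg_add_cancel' (a : MaxQuot A) : -a + a = 0 := by
  induction a using ind with | _ a
  refine mk_eq_of_set (φ := add (neg a) a) (a.dom : Set A) a.dense fun x hx =>
    ⟨⟨hx, hx⟩, mem_ofElem 0 x, ?_⟩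
  exact (neg_add_cancel (a.hom ⟨x, hx⟩)).trans (zero_mul x).symm

instance : CommRing (MaxQuot A) where
  add_assoc := MaxQuot.add_assoc'
  zero_add := MaxQuot.zero_add'
  add_zero a := by rw [MaxQuot.add_comm', MaxQuot.zero_add']
  add_comm := MaxQuot.add_comm'
  neg_add_cancel := MaxQuot.neg_add_cancel'
  mul_assoc := MaxQuot.mul_assoc'
  one_mul := MaxQuot.one_mul'
  mul_one a := by rw [MaxQuot.mul_comm', MaxQuot.one_mul']
  mul_comm := MaxQuot.mul_comm'
  left_distrib := MaxQuot.left_distrib'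
  right_distrib a b c := by
    rw [MaxQuot.mul_comm', MaxQuot.left_distrib', MaxQuot.mul_comm' c, MaxQuot.mul_comm' c]
  zero_mul := MaxQuot.zero_mul'
  mul_zero a := by rw [MaxQuot.mul_comm', MaxQuot.zero_mul']
  nsmul := nsmulRec
  zsmul := zsmulRec

/-- The canonical embedding `A → 𝒬(A)`. -/
def ofRing : A →+* MaxQuot A where
  toFun a := mk (ofElem a)
  map_zero' := rfl
  map_one' := rfl
  map_add' a b := mk_eq_of_set (φ := ofElem (a + b)) (ψ := add (ofElem a) (ofElem b))
    ((⊤ : Ideal A) : Set A) isDenseIdeal_top fun x _ =>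
      ⟨mem_ofElem _ x, ⟨mem_ofElem a x, mem_ofElem b x⟩, add_mul a b x⟩
  map_mul' a b := (mk_ofElem_mul (φ := ofElem b) (χ := ofElem (a * b)) a fun x _ => ⟨mem_ofElem _ x, mul_assoc a b x⟩).symm

instance : Algebra A (MaxQuot A) := ofRing.toAlgebra

end MaxQuot

end MaximalQuotients

/-! ### The idempotents of a commutative ring -/

/-- The Boolean ring `E(A)` of idempotents of a commutative ring `A`: the order is
`e ≤ f ↔ e * f = e`, the product is that of `A`, and the sum is `e + f - 2 * e * f`. -/
abbrev IdempotentRing (A : Type u) [CommRing A] : Type u :=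
  AsBoolRing {e : A // IsIdempotentElem e}

theorem IdempotentRing.coe_mul {A : Type u} [CommRing A] (e f : IdempotentRing A) :
    (ofBoolRing (e * f)).1 = (ofBoolRing e).1 * (ofBoolRing f).1 := rfl

theorem IdempotentRing.coe_add {A : Type u} [CommRing A] (e f : IdempotentRing A) :
    (ofBoolRing (e + f)).1 = (ofBoolRing e).1 + (ofBoolRing f).1 -
      2 * (ofBoolRing e).1 * (ofBoolRing f).1 := by
  have he : (ofBoolRing e).1 * (ofBoolRing e).1 = (ofBoolRing e).1 := (ofBoolRing e).2
  have hf : (ofBoolRing f).1 * (ofBoolRing f).1 = (ofBoolRing f).1 := (ofBoolRing f).2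
  have h : (ofBoolRing (e + f)).1 = (ofBoolRing e).1 * (1 - (ofBoolRing f).1) +
      (ofBoolRing f).1 * (1 - (ofBoolRing e).1) -
      (ofBoolRing e).1 * (1 - (ofBoolRing f).1) *
        ((ofBoolRing f).1 * (1 - (ofBoolRing e).1)) := rfl
  rw [h]
  linear_combination ((ofBoolRing f).1 - (ofBoolRing f).1 ^ 2) * he

/-! ### Rings of continuous functions on a filter base of dense sets -/

/-- A family of dense subsets of `X`, closed under finite intersection. -/
structure DenseFilterBase (X : Type u) [TopologicalSpace X] where
  sets : Set (Set X)
  nonempty : sets.Nonempty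
  dense : ∀ S ∈ sets, Dense S
  inter : ∀ S ∈ sets, ∀ T ∈ sets, S ∩ T ∈ sets

namespace DenseFilterBase

variable {X : Type u} [TopologicalSpace X] (𝒮 : DenseFilterBase X)

/-- The members of the filter base, ordered by reverse inclusion. -/
abbrev Index : Type u := {S : Set X // S ∈ 𝒮.sets}ᵒᵈ

/-- The underlying set of an index. -/
abbrev carrier (i : 𝒮.Index) : Set X := (OrderDual.ofDual i).1

instance : Nonempty 𝒮.Index :=
  let ⟨S, hS⟩ := 𝒮.nonempty
  ⟨OrderDual.toDual ⟨S, hS⟩⟩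

instance : IsDirectedOrder 𝒮.Index where
  directed i j := ⟨OrderDual.toDual ⟨𝒮.carrier i ∩ 𝒮.carrier j,
    𝒮.inter _ (OrderDual.ofDual i).2 _ (OrderDual.ofDual j).2⟩,
    inter_subset_left, inter_subset_right⟩

/-- Restriction of functions `C(S) → C(T)` for `T ⊆ S`. -/
def restrict (i j : 𝒮.Index) (h : i ≤ j) : C(𝒮.carrier i, ℝ) →+* C(𝒮.carrier j, ℝ) :=
  (ContinuousMap.compRightAlgHom ℝ ℝ
    (⟨Set.inclusion h, continuous_inclusion h⟩ : C(𝒮.carrier j, 𝒮.carrier i))).toRingHom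

instance : DirectedSystem (fun i : 𝒮.Index => C(𝒮.carrier i, ℝ)) (𝒮.restrict · · ·) where
  map_self _ _ := rfl
  map_map _ _ _ _ _ _ := rfl

/-- The ring `C[𝒮]`: the direct limit of the rings `C(S)`, `S ∈ 𝒮`. -/
def FunRing : Type u := DirectLimit (fun i : 𝒮.Index => C(𝒮.carrier i, ℝ)) 𝒮.restrict

instance : CommRing 𝒮.FunRing :=
  inferInstanceAs (CommRing (DirectLimit (fun i : 𝒮.Index => C(𝒮.carrier i, ℝ)) 𝒮.restrict))

variable {𝒮}

/-- The element of `C[𝒮]` represented by a continuous function on a member of `𝒮`. -/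
def of (i : 𝒮.Index) (f : C(𝒮.carrier i, ℝ)) : 𝒮.FunRing :=
  (⟦⟨i, f⟩⟧ : DirectLimit (fun i : 𝒮.Index => C(𝒮.carrier i, ℝ)) 𝒮.restrict)

theorem ind {p : 𝒮.FunRing → Prop} (h : ∀ i f, p (of i f)) (a : 𝒮.FunRing) : p a :=
  DirectLimit.induction _ h a

theorem ind₂ {p : 𝒮.FunRing → 𝒮.FunRing → Prop} (h : ∀ i f g, p (of i f) (of i g))
    (a b : 𝒮.FunRing) : p a b :=
  DirectLimit.induction₂ _ h a b

theorem ind₃ {p : 𝒮.FunRing → 𝒮.FunRing → 𝒮.FunRing → Prop}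
    (h : ∀ i f g k, p (of i f) (of i g) (of i k)) (a b c : 𝒮.FunRing) : p a b c :=
  DirectLimit.induction₃ _ h a b c

theorem of_restrict (i j : 𝒮.Index) (h : i ≤ j) (f : C(𝒮.carrier i, ℝ)) :
    of j (𝒮.restrict i j h f) = of i f :=
  DirectLimit.mk_apply (F := fun i : 𝒮.Index => C(𝒮.carrier i, ℝ)) (f := 𝒮.restrict) i j f h

theorem of_add (i : 𝒮.Index) (f g : C(𝒮.carrier i, ℝ)) : of i f + of i g = of i (f + g) :=
  DirectLimit.add_def (G := fun i : 𝒮.Index => C(𝒮.carrier i, ℝ)) (f := 𝒮.restrict)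
    i f g

theorem of_mul (i : 𝒮.Index) (f g : C(𝒮.carrier i, ℝ)) : of i f * of i g = of i (f * g) :=
  DirectLimit.mul_def (G := fun i : 𝒮.Index => C(𝒮.carrier i, ℝ)) (f := 𝒮.restrict)
    i f g

theorem of_sub (i : 𝒮.Index) (f g : C(𝒮.carrier i, ℝ)) : of i f - of i g = of i (f - g) :=
  DirectLimit.sub_def (G := fun i : 𝒮.Index => C(𝒮.carrier i, ℝ)) (f := 𝒮.restrict)
    i f g

theorem of_neg (i : 𝒮.Index) (f : C(𝒮.carrier i, ℝ)) : -of i f = of i (-f) := rfl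

theorem of_zero (i : 𝒮.Index) : of i 0 = (0 : 𝒮.FunRing) := (DirectLimit.zero_def i).symm

theorem of_one (i : 𝒮.Index) : of i 1 = (1 : 𝒮.FunRing) := (DirectLimit.one_def i).symm

variable (𝒮) in
/-- The canonical embedding `C(X) → C[𝒮]`, by restriction. -/
def ofContinuous : C(X, ℝ) →+* 𝒮.FunRing where
  toFun f := of (Classical.arbitrary _) (f.restrict _)
  map_zero' := of_zero _
  map_one' := of_one _
  map_add' f g := (of_add _ (f.restrict _) (g.restrict _)).symm
  map_mul' f g := (of_mul _ (f.restrict _) (g.restrict _)).symm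

theorem ofContinuous_eq (i : 𝒮.Index) (f : C(X, ℝ)) :
    𝒮.ofContinuous f = of i (f.restrict (𝒮.carrier i)) := by
  obtain ⟨k, hk, hik⟩ := exists_ge_ge (Classical.arbitrary 𝒮.Index) i
  exact (of_restrict _ k hk _).symm.trans (of_restrict i k hik (f.restrict (𝒮.carrier i)))

instance : Algebra C(X, ℝ) 𝒮.FunRing := 𝒮.ofContinuous.toAlgebra

variable (𝒮) in
/-- The subring `C*[𝒮]` of bounded functions in `C[𝒮]`. -/
def bounded : Subring 𝒮.FunRing where
  carrier := {a | ∃ (i : 𝒮.Index) (f : C(𝒮.carrier i, ℝ)) (r : ℝ),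
    a = of i f ∧ ∀ x, |f x| ≤ r}
  zero_mem' := ⟨Classical.arbitrary _, 0, 0, (of_zero _).symm, fun x => by simp⟩
  one_mem' := ⟨Classical.arbitrary _, 1, 1, (of_one _).symm, fun x => by simp⟩
  add_mem' := by
    rintro _ _ ⟨i, f, r, rfl, hf⟩ ⟨j, g, s, rfl, hg⟩
    obtain ⟨k, hik, hjk⟩ := exists_ge_ge i j
    refine ⟨k, 𝒮.restrict i k hik f + 𝒮.restrict j k hjk g, r + s, ?_, fun x => ?_⟩
    · rw [← of_add]
      exact congrArg₂ (· + ·) (of_restrict i k hik f).symm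
        (of_restrict j k hjk g).symm
    · exact (abs_add_le _ _).trans (add_le_add (hf _) (hg _))
  mul_mem' := by
    rintro _ _ ⟨i, f, r, rfl, hf⟩ ⟨j, g, s, rfl, hg⟩
    obtain ⟨k, hik, hjk⟩ := exists_ge_ge i j
    refine ⟨k, 𝒮.restrict i k hik f * 𝒮.restrict j k hjk g, r * s, ?_, fun x => ?_⟩
    · rw [← of_mul]
      exact congrArg₂ (· * ·) (of_restrict i k hik f).symm
        (of_restrict j k hjk g).symm
    · refine (abs_mul _ _).trans_le (mul_le_mul (hf _) (hg _) (abs_nonneg _) ?_)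
      exact (abs_nonneg _).trans (hf (Set.inclusion hik x))
  neg_mem' := by
    rintro _ ⟨i, f, r, rfl, hf⟩
    exact ⟨i, -f, r, rfl, fun x => (abs_neg _).trans_le (hf x)⟩

/-! The metric `‖ (a - b) / (1 + |a - b|) ‖` on `C[𝒮]`, where `‖·‖` is the sup norm. -/

theorem frac_lt_one (t : ℝ) : |t| / (1 + |t|) < 1 := by
  rw [div_lt_one (by positivity)]; linarith [abs_nonneg t]

theorem frac_nonneg (t : ℝ) : 0 ≤ |t| / (1 + |t|) := by positivity

theorem frac_add (s t : ℝ) :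
    |s + t| / (1 + |s + t|) ≤ |s| / (1 + |s|) + |t| / (1 + |t|) := by
  have h := abs_add_le s t
  have h1 := abs_nonneg s
  have h2 := abs_nonneg t
  have h3 := abs_nonneg (s + t)
  calc |s + t| / (1 + |s + t|) ≤ (|s| + |t|) / (1 + (|s| + |t|)) := by
        rw [div_le_div_iff₀ (by positivity) (by positivity)]; nlinarith
    _ = |s| / (1 + (|s| + |t|)) + |t| / (1 + (|s| + |t|)) := add_div _ _ _
    _ ≤ _ := by
        gcongr <;> linarith

/-- `sup_x |f x| / (1 + |f x|)`, for a continuous function `f` on a member of `𝒮`. -/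
def supFrac (i : 𝒮.Index) (f : C(𝒮.carrier i, ℝ)) : ℝ :=
  ⨆ x : 𝒮.carrier i, |f x| / (1 + |f x|)

theorem supFrac_bdd (i : 𝒮.Index) (f : C(𝒮.carrier i, ℝ)) :
    BddAbove (range fun x : 𝒮.carrier i => |f x| / (1 + |f x|)) :=
  ⟨1, by rintro _ ⟨x, rfl⟩; exact (frac_lt_one _).le⟩

theorem le_supFrac (i : 𝒮.Index) (f : C(𝒮.carrier i, ℝ)) (x : 𝒮.carrier i) :
    |f x| / (1 + |f x|) ≤ supFrac i f :=
  le_ciSup (supFrac_bdd i f) x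

theorem supFrac_nonneg (i : 𝒮.Index) (f : C(𝒮.carrier i, ℝ)) : 0 ≤ supFrac i f :=
  Real.iSup_nonneg fun _ => frac_nonneg _

theorem supFrac_restrict (i j : 𝒮.Index) (h : i ≤ j) (f : C(𝒮.carrier i, ℝ)) :
    supFrac i f = supFrac j (𝒮.restrict i j h f) := by
  apply le_antisymm
  · refine Real.iSup_le (fun x => ?_) (supFrac_nonneg _ _)
    have hd : DenseRange (Set.inclusion h : 𝒮.carrier j → 𝒮.carrier i) := by
      refine IsInducing.subtypeVal.dense_iff.2 fun x => ?_
      have : (Subtype.val '' range (Set.inclusion h : 𝒮.carrier j → 𝒮.carrier i)) =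
          𝒮.carrier j := by
        rw [← range_comp]; exact Subtype.range_coe
      rw [this]
      exact 𝒮.dense _ (OrderDual.ofDual j).2 _
    have hc : IsClosed {x : 𝒮.carrier i |
        |f x| / (1 + |f x|) ≤ supFrac j (𝒮.restrict i j h f)} := by
      refine isClosed_le (Continuous.div (by fun_prop) (by fun_prop) fun x => ?_)
        continuous_const
      positivity
    exact hd.induction_on x hc fun y => le_supFrac j (𝒮.restrict i j h f) y
  · exact Real.iSup_le (fun x => le_supFrac i f (Set.inclusion h x)) (supFrac_nonneg _ _)

/-- `‖ a / (1 + |a|) ‖` for `a` in `C[𝒮]`; it does not depend on the representative. -/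
def size (a : 𝒮.FunRing) : ℝ :=
  DirectLimit.lift 𝒮.restrict supFrac supFrac_restrict a

theorem size_of (i : 𝒮.Index) (f : C(𝒮.carrier i, ℝ)) : size (of i f) = supFrac i f := rfl

theorem size_neg (a : 𝒮.FunRing) : size (-a) = size a := by
  induction a using ind with | _ i f
  simp [of_neg, size_of, supFrac]

theorem size_add (a b : 𝒮.FunRing) : size (a + b) ≤ size a + size b := by
  induction a, b using ind₂ with | _ i f g
  rw [of_add, size_of, size_of, size_of]
  exact Real.iSup_le (fun x => (frac_add (f x) (g x)).trans
    (add_le_add (le_supFrac i f x) (le_supFrac i g x)))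
    (add_nonneg (supFrac_nonneg i f) (supFrac_nonneg i g))

theorem size_zero : size (0 : 𝒮.FunRing) = 0 := by
  rw [← of_zero (Classical.arbitrary _), size_of]
  simp [supFrac]

theorem eq_zero_of_size (a : 𝒮.FunRing) (h : size a = 0) : a = 0 := by
  induction a using ind with | _ i f
  rw [size_of] at h
  rw [← of_zero i]
  congr 1
  ext x
  have h1 := h ▸ le_supFrac i f x
  have h2 : |f x| / (1 + |f x|) = 0 := le_antisymm h1 (frac_nonneg _)
  have h3 : 1 + |f x| ≠ 0 := by positivity
  simpa [h3] using h2

instance : MetricSpace 𝒮.FunRing where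
  dist a b := size (a - b)
  dist_self a := by rw [sub_self, size_zero]
  dist_comm a b := by rw [← size_neg, neg_sub]
  dist_triangle a b c := by
    rw [← sub_add_sub_cancel a b c]
    exact size_add _ _
  eq_of_dist_eq_zero {a b} h := sub_eq_zero.mp (eq_zero_of_size _ h)

theorem dist_of (i : 𝒮.Index) (f g : C(𝒮.carrier i, ℝ)) :
    dist (of i f) (of i g) = ⨆ x, |f x - g x| / (1 + |f x - g x|) := by
  show size (of i f - of i g) = _
  rw [of_sub]
  rfl

end DenseFilterBase

/-! ### The rings attached to a space -/

/-- The dense open subsets of `X`. -/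
def denseOpens (X : Type u) [TopologicalSpace X] : DenseFilterBase X where
  sets := {V | IsOpen V ∧ Dense V}
  nonempty := ⟨univ, isOpen_univ, dense_univ⟩
  dense _ hV := hV.2
  inter _ hV _ hW := ⟨hV.1.inter hW.1, hV.2.inter_of_isOpen_left hW.2 hV.1⟩

/-- The dense `G_δ` subsets of a Baire space `X`. -/
def denseGδs (X : Type u) [TopologicalSpace X] [BaireSpace X] : DenseFilterBase X where
  sets := {S | IsGδ S ∧ Dense S}
  nonempty := ⟨univ, IsGδ.univ, dense_univ⟩
  dense _ hS := hS.2
  inter _ hS _ hT := ⟨hS.1.inter hT.1, hS.2.inter_of_Gδ hS.1 hT.1 hT.2⟩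

/-- `Q(X)`: the maximal ring of quotients of `C(X)`. -/
abbrev Q (X : Type u) [TopologicalSpace X] : Type u := MaxQuot C(X, ℝ)

/-- The realization of `Q(X)` as the ring of all continuous functions on the dense open sets of
`X`, two functions being identified if they agree on the common part of their domains. -/
abbrev QFun (X : Type u) [TopologicalSpace X] : Type u := (denseOpens X).FunRing

/-- `Q*(X)`: the subring of bounded functions in `Q(X)`. -/
abbrev QStar (X : Type u) [TopologicalSpace X] : Subring (QFun X) := (denseOpens X).bounded

/-- The metric completion of `Q(X)`, realized as the ring of all continuous functions on the dense
`G_δ` sets of the Stone–Čech compactification of `X`. -/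
abbrev QBar (X : Type u) [TopologicalSpace X] : Type u := (denseGδs (StoneCech X)).FunRing

/-- The subring of bounded functions in `QBar X`. -/
abbrev QBarStar (X : Type u) [TopologicalSpace X] : Subring (QBar X) :=
  (denseGδs (StoneCech X)).bounded

end RingsOfQuotients

end

/-!
A commutative ring `R` is an exchange ring if every `a` admits an idempotent `e` with `a ∣ e` and
`1 - a ∣ 1 - e`. Idempotents of such a ring separate its maximal ideals, so that
`M ↦ {e | e ∈ M}` is a homeomorphism from the maximal ideal space of `R` to that of the Boolean
ring of idempotents. Hence two exchange rings with the same idempotents have homeomorphic maximal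
ideal spaces.

Rings of continuous functions on a filter base containing all dense open sets are exchange rings,
and so are their subrings of bounded functions: for a function `f` on `S` and an open set `U` with
`S ∩ U = {1/2 < f}`, take for `e` the indicator of `U`, which is continuous off the frontier of `U`.
On `U` one divides by `f ≥ 1/2`, off `U` by `1 - f ≥ 1/2`. In the same way, every idempotent is such
an indicator, so an idempotent of `QBar X` lives on a dense open subset of `βX` and restricts to an
idempotent of `QFun X`.

A continuous function on a dense subset of `βX` extends continuously to a dense `G_δ` set; this
embeds `QFun X` into `QBar X`. The image is dense because a continuous function on a dense set `S`
is uniformly close to a function that is constant on each of a disjoint family of open sets covering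
`S` densely.

A fraction `φ : D → C(X)` is the function `φ d / d` on the dense open union of the cozero sets of
the `d ∈ D`; conversely, a function `f` on a dense open set `V` is a fraction whose denominators are
the `d` such that `d * f` extends continuously to `X`.
-/

universe u

noncomputable section

namespace RingsOfQuotients

section ExchangeRing

/-- Exchange rings, in the form of Nicholson's criterion for commutative rings: idempotents lift
along the comaximal pair of ideals generated by `a` and `1 - a`. They are the rings whose maximal
ideals are separated by idempotents. -/
def IsExchangeRing (R : Type*) [CommRing R] : Prop :=
  ∀ a : R, ∃ e, IsIdempotentElem e ∧ a ∣ e ∧ 1 - a ∣ 1 - e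

variable {A R : Type*} [CommRing A] [CommRing R]

theorem IsExchangeRing.of_ringEquiv (hR : IsExchangeRing R) (ψ : A ≃+* R) :
    IsExchangeRing A := fun a => by
  obtain ⟨e, he, hae, hae'⟩ := hR (ψ a)
  exact ⟨ψ.symm e, he.map ψ.symm, by simpa using map_dvd ψ.symm hae,
    by simpa using map_dvd ψ.symm hae'⟩

theorem IsExchangeRing.exists_isIdempotentElem_notMem (hR : IsExchangeRing R) {M : Ideal R}
    [hM : M.IsMaximal] {a : R} (ha : a ∉ M) : ∃ e, IsIdempotentElem e ∧ e ∉ M ∧ a ∣ e := by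
  obtain ⟨b, m, hm, hbm⟩ := hM.exists_inv ha
  obtain ⟨e, he, hae, hme⟩ := hR (b * a)
  rw [← hbm, add_sub_cancel_left, hbm] at hme
  refine ⟨e, he, fun heM => hM.isPrime.one_notMem ?_, (dvd_mul_left a b).trans hae⟩
  simpa using M.add_mem heM (M.mem_of_dvd hme hm)

theorem isOpen_maximalSpectrum_iff {U : Set (MaximalSpectrum R)} :
    IsOpen U ↔ ∀ M ∈ U, ∃ a ∉ M.asIdeal, ∀ N : MaximalSpectrum R, a ∉ N.asIdeal → N ∈ U := by
  have hbasis := PrimeSpectrum.isTopologicalBasis_basic_opens.induced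
    (MaximalSpectrum.toPrimeSpectrum (R := R))
  rw [hbasis.isOpen_iff]
  refine forall₂_congr fun M _ => ⟨?_, ?_⟩
  · rintro ⟨_, ⟨_, ⟨a, rfl⟩, rfl⟩, haM, haU⟩
    exact ⟨a, haM, fun N haN => haU haN⟩
  · rintro ⟨a, haM, haU⟩
    exact ⟨_, ⟨_, ⟨a, rfl⟩, rfl⟩, haM, fun N haN => haU N haN⟩

end ExchangeRing

section IdempotentTrace

variable {A : Type u} {R : Type*} [CommRing A] [CommRing R]

theorem IdempotentRing.coe_one_add (e : IdempotentRing A) :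
    (ofBoolRing (1 + e)).1 = 1 - (ofBoolRing e).1 := by
  have coe_one : (ofBoolRing (1 : IdempotentRing A)).1 = 1 := rfl
  rw [IdempotentRing.coe_add, coe_one]
  ring

/-- The trace of an ideal `M` of `R` on the Boolean ring of idempotents of `A`, along a
homomorphism `f : A →+* R`. -/
def idempotentTrace (f : A →+* R) (M : Ideal R) : Ideal (IdempotentRing A) where
  carrier := {e | f (ofBoolRing e).1 ∈ M}
  zero_mem' := by
    change f 0 ∈ M
    simp only [map_zero, M.zero_mem]
  add_mem' {e e'} he he' := by
    change f _ ∈ M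
    rw [IdempotentRing.coe_add, map_sub, map_add, map_mul]
    exact M.sub_mem (M.add_mem he he') (M.mul_mem_left _ he')
  smul_mem' c e he := by
    change f (ofBoolRing (c * e)).1 ∈ M
    rw [IdempotentRing.coe_mul, map_mul]
    exact M.mul_mem_left _ he

variable {f : A →+* R}

theorem map_one_add_mul_self (f : A →+* R) (e : IdempotentRing A) :
    f (ofBoolRing (1 + e)).1 * f (ofBoolRing e).1 = 0 := by
  rw [← map_mul, IdempotentRing.coe_one_add, sub_mul, one_mul, (ofBoolRing e).2.eq, sub_self,
    map_zero]

theorem isMaximal_idempotentTrace (f : A →+* R) (M : Ideal R) [hM : M.IsMaximal] :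
    (idempotentTrace f M).IsMaximal := by
  refine Ideal.isMaximal_iff.2
    ⟨fun h1 => hM.isPrime.one_notMem (map_one f ▸ h1), fun J e hJ he heJ => ?_⟩
  have he' : 1 + e ∈ J := hJ <| (hM.isPrime.mem_or_mem
    (map_one_add_mul_self f e ▸ M.zero_mem)).resolve_right he
  have : 1 = (1 + e) + e := by rw [add_assoc, BooleanRing.add_self, add_zero]
  exact this ▸ J.add_mem he' heJ

theorem exists_one_add_mul_eq_zero_of_mem_span {P : Ideal (IdempotentRing A)} {x : R}
    (hx : x ∈ Ideal.span ((fun e : IdempotentRing A => f (ofBoolRing e).1) '' P)) :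
    ∃ p ∈ P, f (ofBoolRing (1 + p)).1 * x = 0 := by
  induction hx using Submodule.span_induction with
  | mem x hx =>
    obtain ⟨p, hp, rfl⟩ := hx
    exact ⟨p, hp, map_one_add_mul_self f p⟩
  | zero => exact ⟨0, P.zero_mem, mul_zero _⟩
  | add x y _ _ hx hy =>
    obtain ⟨p, hp, hpx⟩ := hx
    obtain ⟨q, hq, hqy⟩ := hy
    refine ⟨p + q + p * q, P.add_mem (P.add_mem hp hq) (P.mul_mem_left _ hq), ?_⟩
    have h_mul : 1 + (p + q + p * q) = (1 + p) * (1 + q) := by ring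
    rw [h_mul, IdempotentRing.coe_mul, map_mul]
    linear_combination f (ofBoolRing (1 + q)).1 * hpx + f (ofBoolRing (1 + p)).1 * hqy
  | smul a x _ hx =>
    obtain ⟨p, hp, hpx⟩ := hx
    exact ⟨p, hp, by rw [smul_eq_mul, mul_left_comm, hpx, mul_zero]⟩

theorem exists_idempotentTrace_eq (hf : Function.Injective f) (P : Ideal (IdempotentRing A))
    [hP : P.IsMaximal] : ∃ M : Ideal R, M.IsMaximal ∧ idempotentTrace f M = P := by
  have hne : Ideal.span ((fun e : IdempotentRing A => f (ofBoolRing e).1) '' P) ≠ ⊤ := by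
    rw [Ideal.ne_top_iff_one]
    intro h1
    obtain ⟨p, hp, hp0⟩ := exists_one_add_mul_eq_zero_of_mem_span h1
    rw [mul_one, map_eq_zero_iff f hf, IdempotentRing.coe_one_add, sub_eq_zero] at hp0
    have hp1 : 1 = p := ofBoolRing.injective (Subtype.ext hp0)
    exact hP.isPrime.one_notMem (hp1 ▸ hp)
  obtain ⟨M, hM, hPM⟩ := Ideal.exists_le_maximal _ hne
  refine ⟨M, hM, (hP.eq_of_le (isMaximal_idempotentTrace f M).ne_top fun p hp => ?_).symm⟩
  exact hPM (Ideal.subset_span ⟨p, hp, rfl⟩)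

theorem IsExchangeRing.exists_notMem_idempotentTrace (hR : IsExchangeRing R)
    (hf : Function.Injective f) (hfE : ∀ r : R, IsIdempotentElem r → r ∈ f.range) {M : Ideal R}
    [M.IsMaximal] {a : R} (ha : a ∉ M) :
    ∃ e : IdempotentRing A, e ∉ idempotentTrace f M ∧ a ∣ f (ofBoolRing e).1 := by
  obtain ⟨r, hr, hrM, har⟩ := hR.exists_isIdempotentElem_notMem ha
  obtain ⟨e, rfl⟩ := hfE r hr
  exact ⟨toBoolRing ⟨e, hf (by rw [map_mul, hr.eq])⟩, hrM, har⟩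

/-- The map of maximal ideal spaces that sends a maximal ideal to its trace on the idempotents. -/
def maximalSpectrumTrace (f : A →+* R) (M : MaximalSpectrum R) :
    MaximalSpectrum (IdempotentRing A) :=
  have := M.isMaximal
  ⟨idempotentTrace f M.asIdeal, isMaximal_idempotentTrace f M.asIdeal⟩

theorem continuous_maximalSpectrumTrace : Continuous (maximalSpectrumTrace f) := by
  refine ⟨fun U hU => isOpen_maximalSpectrum_iff.2 fun M hM => ?_⟩
  obtain ⟨e, heM, heU⟩ := isOpen_maximalSpectrum_iff.1 hU _ hM
  exact ⟨f (ofBoolRing e).1, heM, fun N heN => heU _ heN⟩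

theorem surjective_maximalSpectrumTrace (hf : Function.Injective f) :
    Function.Surjective (maximalSpectrumTrace f) := fun P => by
  have := P.isMaximal
  obtain ⟨M, hM, hMP⟩ := exists_idempotentTrace_eq hf P.asIdeal
  exact ⟨⟨M, hM⟩, MaximalSpectrum.ext hMP⟩

theorem IsExchangeRing.injective_maximalSpectrumTrace (hR : IsExchangeRing R)
    (hf : Function.Injective f) (hfE : ∀ r : R, IsIdempotentElem r → r ∈ f.range) :
    Function.Injective (maximalSpectrumTrace f) := fun M N hMN => by
  have hM := M.isMaximal
  refine MaximalSpectrum.ext (N.isMaximal.eq_of_le hM.ne_top fun a haN => ?_).symm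
  by_contra haM
  obtain ⟨e, heM, hae⟩ := hR.exists_notMem_idempotentTrace hf hfE haM
  have htrace : idempotentTrace f M.asIdeal = idempotentTrace f N.asIdeal :=
    congrArg MaximalSpectrum.asIdeal hMN
  exact heM (htrace ▸ N.asIdeal.mem_of_dvd hae haN)

theorem IsExchangeRing.isOpenMap_maximalSpectrumTrace (hR : IsExchangeRing R)
    (hf : Function.Injective f) (hfE : ∀ r : R, IsIdempotentElem r → r ∈ f.range) :
    IsOpenMap (maximalSpectrumTrace f) := by
  refine fun U hU => isOpen_maximalSpectrum_iff.2 ?_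
  rintro _ ⟨M, hM, rfl⟩
  have := M.isMaximal
  obtain ⟨a, haM, haU⟩ := isOpen_maximalSpectrum_iff.1 hU M hM
  obtain ⟨e, heM, hae⟩ := hR.exists_notMem_idempotentTrace hf hfE haM
  refine ⟨e, heM, fun P heP => ?_⟩
  obtain ⟨N, rfl⟩ := surjective_maximalSpectrumTrace hf P
  exact ⟨N, haU N fun haN => heP (N.asIdeal.mem_of_dvd hae haN), rfl⟩

/-- If `f : A →+* R` identifies the idempotents of `A` with those of the exchange ring `R`, then
the maximal ideals of `R` are determined by their traces on the idempotents of `A`. -/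
def IsExchangeRing.homeomorphIdempotentRing (hR : IsExchangeRing R) (f : A →+* R)
    (hf : Function.Injective f) (hfE : ∀ r : R, IsIdempotentElem r → r ∈ f.range) :
    MaximalSpectrum R ≃ₜ MaximalSpectrum (IdempotentRing A) :=
  (Equiv.ofBijective (maximalSpectrumTrace f) ⟨hR.injective_maximalSpectrumTrace hf hfE,
    surjective_maximalSpectrumTrace hf⟩).toHomeomorphOfContinuousOpen
    continuous_maximalSpectrumTrace (hR.isOpenMap_maximalSpectrumTrace hf hfE)

/-- Exchange rings with the same idempotents have the same maximal ideal space. -/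
def IsExchangeRing.homeomorphOfRingHom (hA : IsExchangeRing A) (hR : IsExchangeRing R)
    (f : A →+* R) (hf : Function.Injective f)
    (hfE : ∀ r : R, IsIdempotentElem r → r ∈ f.range) :
    MaximalSpectrum A ≃ₜ MaximalSpectrum R :=
  (hA.homeomorphIdempotentRing (RingHom.id A) Function.injective_id fun a _ => ⟨a, rfl⟩).trans
    (hR.homeomorphIdempotentRing f hf hfE).symm

end IdempotentTrace

section RecognitionOfMaxQuot

variable {A : Type u} [CommRing A] {B : Type*} [CommRing B] [Algebra A B]

/-- Multiplication by `b` is the homomorphism `φ`, as far as `φ` is defined. -/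
def DenseHom.Represents (φ : DenseHom A) (b : B) : Prop :=
  ∀ d : φ.dom, (d : A) • b = algebraMap A B (φ.hom d)

theorem DenseHom.represents_ofElem (a : A) : (ofElem a).Represents (algebraMap A B a) := by
  rintro ⟨d, hd⟩
  rw [MaxQuot.ofElem_hom, Algebra.smul_def, map_mul, mul_comm]

theorem DenseHom.Represents.add {φ ψ : DenseHom A} {b c : B} (hφ : φ.Represents b)
    (hψ : ψ.Represents c) : (φ.add ψ).Represents (b + c) := by
  rintro ⟨d, hdφ, hdψ⟩
  rw [add_hom φ ψ hdφ hdψ, smul_add, hφ ⟨d, hdφ⟩, hψ ⟨d, hdψ⟩, map_add]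

theorem DenseHom.Represents.mul {φ ψ : DenseHom A} {b c : B} (hφ : φ.Represents b)
    (hψ : ψ.Represents c) : (φ.mul ψ).Represents (b * c) := by
  intro d
  have hdψ : (d : A) • c = algebraMap A B (ψ.hom ⟨d, Ideal.mul_le_right d.2⟩) :=
    hψ ⟨d, _⟩
  rw [mul_comm b c, ← smul_mul_assoc, hdψ, ← Algebra.smul_def]
  exact hφ ⟨_, hom_mem_of_mem_mul ψ d.2 _⟩

theorem DenseHom.Represents.rel {φ ψ : DenseHom A} {b : B}
    (hinj : Function.Injective (algebraMap A B)) (hφ : φ.Represents b) (hψ : ψ.Represents b) :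
    φ.Rel ψ := fun d hdφ hdψ => hinj <| by
  rw [← hφ ⟨d, hdφ⟩, ← hψ ⟨d, hdψ⟩]

/-- The elements `d` of `A` such that `d • b` comes from `A`. -/
def denominators (A : Type*) [CommRing A] {B : Type*} [CommRing B] [Algebra A B] (b : B) :
    Ideal A :=
  (LinearMap.range (Algebra.linearMap A B)).comap (LinearMap.toSpanSingleton A B b)

theorem DenseHom.exists_represents (hinj : Function.Injective (algebraMap A B)) {b : B}
    (hb : IsDenseIdeal (denominators A b)) : ∃ φ : DenseHom A, φ.Represents b := by
  let range_equiv := LinearEquiv.ofInjective (Algebra.linearMap A B) hinj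
  let smul_b : denominators A b →ₗ[A] LinearMap.range (Algebra.linearMap A B) :=
    (LinearMap.toSpanSingleton A B b).restrict fun _ hd => hd
  refine ⟨⟨denominators A b, hb, range_equiv.symm ∘ₗ smul_b⟩, fun d => ?_⟩
  exact congrArg Subtype.val (range_equiv.apply_symm_apply (smul_b d)).symm

/-- An internal characterization of the maximal ring of quotients of `A` among all `A`-algebras. -/
structure IsMaxQuot (A : Type*) [CommRing A] (B : Type*) [CommRing B] [Algebra A B] : Prop where
  injective_algebraMap : Function.Injective (algebraMap A B)
  eq_zero_of_smul_eq_zero : ∀ D : Ideal A, IsDenseIdeal D → ∀ b : B, (∀ d ∈ D, d • b = 0) → b = 0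
  exists_represents : ∀ φ : DenseHom A, ∃ b : B, φ.Represents b
  isDenseIdeal_denominators : ∀ b : B, IsDenseIdeal (denominators A b)

namespace IsMaxQuot

theorem eq_of_rel (hB : IsMaxQuot A B) {φ ψ : DenseHom A} {b c : B} (hφψ : φ.Rel ψ)
    (hφ : φ.Represents b) (hψ : ψ.Represents c) : b = c :=
  sub_eq_zero.1 <| hB.eq_zero_of_smul_eq_zero _ (φ.dense.inf ψ.dense) _ fun d hd => by
    rw [smul_sub, hφ ⟨d, hd.1⟩, hψ ⟨d, hd.2⟩, hφψ d hd.1 hd.2, sub_self]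

/-- The element of `B` that represents an element of the maximal ring of quotients. -/
def representative (hB : IsMaxQuot A B) : MaxQuot A → B :=
  Quotient.lift (fun φ => (hB.exists_represents φ).choose) fun φ ψ h =>
    hB.eq_of_rel h (hB.exists_represents φ).choose_spec (hB.exists_represents ψ).choose_spec

theorem represents_representative (hB : IsMaxQuot A B) (φ : DenseHom A) :
    φ.Represents (hB.representative (MaxQuot.mk φ)) :=
  (hB.exists_represents φ).choose_spec

theorem representative_eq (hB : IsMaxQuot A B) {φ : DenseHom A} {b : B} (h : φ.Represents b) :
    hB.representative (MaxQuot.mk φ) = b :=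
  hB.eq_of_rel (fun _ _ _ => rfl) (hB.represents_representative φ) h

theorem bijective_representative (hB : IsMaxQuot A B) : Function.Bijective hB.representative := by
  refine ⟨fun a b => ?_, fun b => ?_⟩
  · induction a using MaxQuot.ind with | _ φ
    induction b using MaxQuot.ind with | _ ψ
    refine fun h => Quotient.sound <|
      (hB.represents_representative φ).rel hB.injective_algebraMap ?_
    exact h ▸ hB.represents_representative ψ
  · obtain ⟨φ, hφ⟩ :=
      DenseHom.exists_represents hB.injective_algebraMap (hB.isDenseIdeal_denominators b)
    exact ⟨MaxQuot.mk φ, hB.representative_eq hφ⟩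

/-- Taking representatives is a homomorphism of `A`-algebras. -/
def representativeHom (hB : IsMaxQuot A B) : MaxQuot A →ₐ[A] B where
  toFun := hB.representative
  map_one' := (hB.representative_eq (DenseHom.represents_ofElem 1)).trans (map_one _)
  map_zero' := (hB.representative_eq (DenseHom.represents_ofElem 0)).trans (map_zero _)
  map_add' a b := by
    induction a using MaxQuot.ind with | _ φ
    induction b using MaxQuot.ind with | _ ψ
    exact hB.representative_eq
      ((hB.represents_representative φ).add (hB.represents_representative ψ))
  map_mul' a b := by
    induction a using MaxQuot.ind with | _ φ
    induction b using MaxQuot.ind with | _ ψ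
    exact hB.representative_eq
      ((hB.represents_representative φ).mul (hB.represents_representative ψ))
  commutes' a := hB.representative_eq (DenseHom.represents_ofElem a)

/-- The isomorphism of the maximal ring of quotients with any algebra satisfying `IsMaxQuot`. -/
def algEquiv (hB : IsMaxQuot A B) : MaxQuot A ≃ₐ[A] B :=
  AlgEquiv.ofBijective hB.representativeHom hB.bijective_representative

end IsMaxQuot

end RecognitionOfMaxQuot

namespace DenseFilterBase

section FunctionsOnX

variable {X : Type u} [TopologicalSpace X] {𝒮 : DenseFilterBase X}

/-- The element of `C[𝒮]` represented by the restriction to `S ∈ 𝒮` of a total function `f`; the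
values of `f` off `S` are irrelevant. -/
def mkOn (S : Set X) (hS : S ∈ 𝒮.sets) (f : X → ℝ) (hf : ContinuousOn f S) : 𝒮.FunRing :=
  of (OrderDual.toDual ⟨S, hS⟩) ⟨S.domRestrict f, hf.domRestrict⟩

theorem exists_eq_mkOn (a : 𝒮.FunRing) : ∃ S hS f hf, a = mkOn S hS f hf := by
  induction a using ind with | _ i f
  let F : X → ℝ := Function.extend Subtype.val f 0
  have hF : (𝒮.carrier i).domRestrict F = f :=
    funext fun x => Subtype.val_injective.extend_apply f 0 x
  have hFc : ContinuousOn F (𝒮.carrier i) := by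
    rw [continuousOn_iff_continuous_domRestrict, hF]
    exact f.continuous
  exact ⟨_, (OrderDual.ofDual i).2, F, hFc, congrArg (of i) (ContinuousMap.ext (congrFun hF.symm))⟩

variable {S T D : Set X} {hS : S ∈ 𝒮.sets} {hT : T ∈ 𝒮.sets} {f g : X → ℝ}
  {hf : ContinuousOn f S} {hg : ContinuousOn g S}

theorem mkOn_mono (hT : T ∈ 𝒮.sets) (hTS : T ⊆ S) (hf : ContinuousOn f S) :
    mkOn S hS f hf = mkOn T hT f (hf.mono hTS) :=
  (of_restrict (OrderDual.toDual ⟨S, hS⟩) (OrderDual.toDual ⟨T, hT⟩) hTS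
    ⟨S.domRestrict f, hf.domRestrict⟩).symm

theorem mkOn_congr (h : EqOn f g S) : mkOn S hS f hf = mkOn S hS g hg :=
  congrArg (of _) (ContinuousMap.ext fun x => h x.2)

theorem mkOn_add (hf : ContinuousOn f S) (hg : ContinuousOn g S) :
    mkOn S hS f hf + mkOn S hS g hg = mkOn S hS (fun x => f x + g x) (hf.add hg) :=
  of_add _ _ _

theorem mkOn_sub (hf : ContinuousOn f S) (hg : ContinuousOn g S) :
    mkOn S hS f hf - mkOn S hS g hg = mkOn S hS (fun x => f x - g x) (hf.sub hg) :=
  of_sub _ _ _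

theorem mkOn_mul (hf : ContinuousOn f S) (hg : ContinuousOn g S) :
    mkOn S hS f hf * mkOn S hS g hg = mkOn S hS (fun x => f x * g x) (hf.mul hg) :=
  of_mul _ _ _

theorem mkOn_zero (hS : S ∈ 𝒮.sets) : mkOn S hS (fun _ => 0) continuousOn_const = 0 :=
  of_zero _

theorem mkOn_one (hS : S ∈ 𝒮.sets) : mkOn S hS (fun _ => 1) continuousOn_const = 1 :=
  of_one _

theorem algebraMap_eq_mkOn (hS : S ∈ 𝒮.sets) (d : C(X, ℝ)) :
    algebraMap C(X, ℝ) 𝒮.FunRing d = mkOn S hS d d.continuous.continuousOn :=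
  ofContinuous_eq _ d

theorem smul_mkOn (d : C(X, ℝ)) (hf : ContinuousOn f S) :
    d • mkOn S hS f hf = mkOn S hS (fun x => d x * f x) (d.continuous.continuousOn.mul hf) := by
  rw [Algebra.smul_def, algebraMap_eq_mkOn hS, mkOn_mul]

theorem mkOn_mem_bounded {r : ℝ} (h : ∀ x ∈ S, |f x| ≤ r) : mkOn S hS f hf ∈ 𝒮.bounded :=
  ⟨_, _, r, rfl, fun x => h x x.2⟩

theorem frac_le_frac_iff {s t : ℝ} (hs : 0 ≤ s) (ht : 0 ≤ t) :
    s / (1 + s) ≤ t / (1 + t) ↔ s ≤ t := by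
  rw [div_le_div_iff₀ (by positivity) (by positivity), mul_one_add, mul_one_add, mul_comm t s,
    add_le_add_iff_right]

theorem dist_mkOn_le_iff (hD : Dense D) (hDS : D ⊆ S) {c : ℝ} (hc : 0 ≤ c) :
    dist (mkOn S hS f hf) (mkOn S hS g hg) ≤ c ↔ ∀ x ∈ D, |f x - g x| / (1 + |f x - g x|) ≤ c := by
  have hdist : dist (mkOn S hS f hf) (mkOn S hS g hg) =
      ⨆ x : S, |f x - g x| / (1 + |f x - g x|) := dist_of _ _ _
  have hbdd : BddAbove (range fun x : S => |f x - g x| / (1 + |f x - g x|)) :=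
    ⟨1, forall_mem_range.2 fun _ => (frac_lt_one _).le⟩
  have hcont : ContinuousOn (fun x => |f x - g x| / (1 + |f x - g x|)) S :=
    (hf.sub hg).abs.div (continuousOn_const.add (hf.sub hg).abs) fun x _ => by positivity
  rw [hdist]
  refine ⟨fun h x hx => (le_ciSup hbdd ⟨x, hDS hx⟩).trans h, fun h => Real.iSup_le (fun x => ?_) hc⟩
  exact ((hcont x x.2).mono hDS).closure_le (hD x) continuousWithinAt_const h

theorem dist_mkOn_le_frac_iff (hD : Dense D) (hDS : D ⊆ S) {ε : ℝ} (hε : 0 ≤ ε) :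
    dist (mkOn S hS f hf) (mkOn S hS g hg) ≤ ε / (1 + ε) ↔ ∀ x ∈ D, |f x - g x| ≤ ε := by
  rw [dist_mkOn_le_iff hD hDS (by positivity)]
  exact forall₂_congr fun x _ => frac_le_frac_iff (abs_nonneg _) hε

theorem mkOn_eq_iff (hD : Dense D) (hDS : D ⊆ S) :
    mkOn S hS f hf = mkOn S hS g hg ↔ EqOn f g D := by
  have h := dist_mkOn_le_frac_iff (hS := hS) (hf := hf) (hg := hg) hD hDS le_rfl
  simpa only [zero_div, dist_le_zero, abs_nonpos_iff, sub_eq_zero, EqOn] using h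

theorem mkOn_eq_mkOn_of_eqOn {hg : ContinuousOn g T} (hD : Dense D) (hDS : D ⊆ S) (hDT : D ⊆ T)
    (h : EqOn f g D) : mkOn S hS f hf = mkOn T hT g hg := by
  rw [mkOn_mono (𝒮.inter S hS T hT) inter_subset_left,
    mkOn_mono (𝒮.inter S hS T hT) inter_subset_right]
  exact (mkOn_eq_iff hD (subset_inter hDS hDT)).2 h

end FunctionsOnX

section Idempotents

variable {X : Type u} [TopologicalSpace X] {𝒮 : DenseFilterBase X} {S U : Set X} {f : X → ℝ}

theorem compl_frontier_mem_denseOpens (hU : IsOpen U) : (frontier U)ᶜ ∈ (denseOpens X).sets := by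
  refine ⟨isClosed_frontier.isOpen_compl, interior_eq_empty_iff_dense_compl.1 ?_⟩
  rw [← frontier_compl, interior_frontier hU.isClosed_compl]

theorem continuousOn_indicator (hSU : Disjoint S (frontier U)) (hf : ContinuousOn f (S ∩ U)) :
    ContinuousOn (U.indicator f) S := by
  classical
  rw [← piecewise_eq_indicator]
  have hempty : S ∩ frontier U = ∅ := hSU.inter_eq
  refine ContinuousOn.piecewise' ?_ ?_ hf continuousOn_const <;>
    simp only [hempty, mem_empty_iff_false, false_imp_iff, implies_true]

theorem exists_mem_bounded_mul_eq_indicator {hS : S ∈ 𝒮.sets} {hf : ContinuousOn f S}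
    (hSU : Disjoint S (frontier U)) {r : ℝ} (hr : 0 < r) (hrf : ∀ x ∈ S ∩ U, r ≤ |f x|) :
    ∃ b ∈ 𝒮.bounded, mkOn S hS f hf * b =
      mkOn S hS (U.indicator 1) (continuousOn_indicator hSU continuousOn_const) := by
  have hf0 : ∀ x ∈ S ∩ U, f x ≠ 0 := fun x hx => abs_pos.1 (hr.trans_le (hrf x hx))
  have hinv : ContinuousOn (U.indicator fun x => (f x)⁻¹) S :=
    continuousOn_indicator hSU ((hf.mono inter_subset_left).inv₀ hf0)
  refine ⟨mkOn S hS _ hinv, mkOn_mem_bounded (r := r⁻¹) fun x hx => ?_, ?_⟩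
  · by_cases hxU : x ∈ U
    · rw [indicator_of_mem hxU, abs_inv]
      exact inv_anti₀ hr (hrf x ⟨hx, hxU⟩)
    · rw [indicator_of_notMem hxU, abs_zero]
      positivity
  · rw [mkOn_mul]
    refine mkOn_congr fun x hx => ?_
    by_cases hxU : x ∈ U
    · simp only [indicator_of_mem hxU, mul_inv_cancel₀ (hf0 x ⟨hx, hxU⟩), Pi.one_apply]
    · simp only [indicator_of_notMem hxU, mul_zero]

theorem isIdempotentElem_mkOn_iff {hS : S ∈ 𝒮.sets} {hf : ContinuousOn f S} :
    IsIdempotentElem (mkOn S hS f hf) ↔ ∀ x ∈ S, f x = 0 ∨ f x = 1 := by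
  rw [IsIdempotentElem, mkOn_mul, mkOn_eq_iff (𝒮.dense S hS) subset_rfl]
  exact forall₂_congr fun x _ => IsIdempotentElem.iff_eq_zero_or_one

theorem mem_bounded_of_isIdempotentElem {a : 𝒮.FunRing} (ha : IsIdempotentElem a) :
    a ∈ 𝒮.bounded := by
  obtain ⟨S, hS, f, hf, rfl⟩ := exists_eq_mkOn a
  refine mkOn_mem_bounded (r := 1) fun x hx => ?_
  rcases isIdempotentElem_mkOn_iff.1 ha x hx with h | h <;> simp [h]

theorem exists_isOpen_mem_iff_lt (hf : ContinuousOn f S) (c : ℝ) :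
    ∃ U, IsOpen U ∧ ∀ x ∈ S, x ∈ U ↔ c < f x := by
  obtain ⟨U, hU, hUS⟩ := continuousOn_iff'.1 hf (Ioi c) isOpen_Ioi
  exact ⟨U, hU, fun x hx => by simpa [hx] using (Set.ext_iff.1 hUS x).symm⟩

theorem exists_eq_indicator_of_isIdempotentElem (h𝒮 : (denseOpens X).sets ⊆ 𝒮.sets)
    {a : 𝒮.FunRing} (ha : IsIdempotentElem a) :
    ∃ (U : Set X) (hU : IsOpen U), a = mkOn (frontier U)ᶜ (h𝒮 (compl_frontier_mem_denseOpens hU))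
      (U.indicator 1) (continuousOn_indicator disjoint_compl_left continuousOn_const) := by
  obtain ⟨S, hS, f, hf, rfl⟩ := exists_eq_mkOn a
  obtain ⟨U, hU, hUf⟩ := exists_isOpen_mem_iff_lt hf (1 / 2)
  have hdense := 𝒮.dense _ (𝒮.inter S hS _ (h𝒮 (compl_frontier_mem_denseOpens hU)))
  refine ⟨U, hU, mkOn_eq_mkOn_of_eqOn hdense inter_subset_left inter_subset_right fun x hx => ?_⟩
  rcases isIdempotentElem_mkOn_iff.1 ha x hx.1 with h | h <;>
    norm_num [indicator, hUf x hx.1, h]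

theorem exists_isIdempotentElem_factors (h𝒮 : (denseOpens X).sets ⊆ 𝒮.sets) (a : 𝒮.FunRing) :
    ∃ e, IsIdempotentElem e ∧ (∃ b ∈ 𝒮.bounded, a * b = e) ∧
      ∃ c ∈ 𝒮.bounded, (1 - a) * c = 1 - e := by
  obtain ⟨S, hS, f, hf, rfl⟩ := exists_eq_mkOn a
  obtain ⟨U, hU, hUf⟩ := exists_isOpen_mem_iff_lt hf (1 / 2)
  have hT := 𝒮.inter S hS _ (h𝒮 (compl_frontier_mem_denseOpens hU))
  have hTU : Disjoint (S ∩ (frontier U)ᶜ) (frontier U) :=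
    disjoint_compl_left.mono_left inter_subset_right
  have hTUc : Disjoint (S ∩ (frontier U)ᶜ) (frontier Uᶜ) := by rwa [frontier_compl]
  rw [mkOn_mono hT inter_subset_left hf, ← mkOn_one hT, mkOn_sub]
  have hlarge : ∀ x ∈ S ∩ (frontier U)ᶜ ∩ U, 1 / 2 ≤ |f x| := fun x hx =>
    ((hUf x hx.1.1).1 hx.2).le.trans (le_abs_self _)
  have hsmall : ∀ x ∈ S ∩ (frontier U)ᶜ ∩ Uᶜ, 1 / 2 ≤ |1 - f x| := fun x hx =>
    le_trans (by linarith [not_lt.1 ((hUf x hx.1.1).not.1 hx.2)]) (le_abs_self (1 - f x))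
  refine ⟨_, isIdempotentElem_mkOn_iff.2 fun x _ => ?_,
    exists_mem_bounded_mul_eq_indicator hTU one_half_pos hlarge, ?_⟩
  · exact (em (x ∈ U)).symm.imp (indicator_of_notMem · 1) (indicator_of_mem · 1)
  · obtain ⟨c, hc, hmul⟩ := exists_mem_bounded_mul_eq_indicator hTUc one_half_pos hsmall
    refine ⟨c, hc, hmul.trans ?_⟩
    rw [mkOn_sub]
    exact mkOn_congr fun x _ => congrFun (indicator_compl U 1) x

theorem isExchangeRing (h𝒮 : (denseOpens X).sets ⊆ 𝒮.sets) : IsExchangeRing 𝒮.FunRing := fun a => by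
  obtain ⟨e, he, ⟨b, -, hb⟩, c, -, hc⟩ := exists_isIdempotentElem_factors h𝒮 a
  exact ⟨e, he, ⟨b, hb.symm⟩, c, hc.symm⟩

theorem isExchangeRing_bounded (h𝒮 : (denseOpens X).sets ⊆ 𝒮.sets) :
    IsExchangeRing 𝒮.bounded := fun a => by
  obtain ⟨e, he, ⟨b, hb, hab⟩, c, hc, hac⟩ := exists_isIdempotentElem_factors h𝒮 a.1
  exact ⟨⟨e, mem_bounded_of_isIdempotentElem he⟩, Subtype.ext he,
    ⟨⟨b, hb⟩, Subtype.ext hab.symm⟩, ⟨c, hc⟩, Subtype.ext hac.symm⟩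

/-- The bounded functions have the same maximal ideal space as all the functions, as all idempotents
are bounded. -/
def homeomorphMaximalSpectrumBounded (h𝒮 : (denseOpens X).sets ⊆ 𝒮.sets) :
    MaximalSpectrum 𝒮.bounded ≃ₜ MaximalSpectrum 𝒮.FunRing :=
  (isExchangeRing_bounded h𝒮).homeomorphOfRingHom (isExchangeRing h𝒮) 𝒮.bounded.subtype
    Subtype.val_injective fun a ha => ⟨⟨a, mem_bounded_of_isIdempotentElem ha⟩, rfl⟩

end Idempotents

section UniformConvergence

open Filter Uniformity

variable {X : Type u} [TopologicalSpace X] {𝒮 : DenseFilterBase X} {S : Set X} {hS : S ∈ 𝒮.sets}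
  {ι : Type*} {f : ι → X → ℝ} {hf : ∀ i, ContinuousOn (f i) S}

theorem uniformity_basis_dist_le_frac (α : Type*) [PseudoMetricSpace α] :
    (𝓤 α).HasBasis (fun ε : ℝ => 0 < ε) fun ε => {p : α × α | dist p.1 p.2 ≤ ε / (1 + ε)} :=
  Metric.mk_uniformity_basis_le (fun ε hε => by positivity) fun ε hε =>
    ⟨ε, hε, div_le_self hε.le (by linarith)⟩

theorem tendsto_mkOn_iff {g : X → ℝ} {hg : ContinuousOn g S} {l : Filter ι} :
    Tendsto (fun i => mkOn S hS (f i) (hf i)) l (𝓝 (mkOn S hS g hg)) ↔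
      TendstoUniformlyOn f g l S := by
  rw [(nhds_basis_uniformity' (uniformity_basis_dist_le_frac _)).tendsto_right_iff,
    Metric.uniformity_basis_dist_le.tendstoUniformlyOn_iff_of_uniformity]
  refine forall₂_congr fun ε hε => eventually_congr (.of_forall fun i => ?_)
  change dist (mkOn S hS g hg) (mkOn S hS (f i) (hf i)) ≤ _ ↔ _
  exact dist_mkOn_le_frac_iff (𝒮.dense S hS) subset_rfl hε.le

theorem cauchySeq_mkOn_iff [Nonempty ι] [SemilatticeSup ι] :
    CauchySeq (fun i => mkOn S hS (f i) (hf i)) ↔ UniformCauchySeqOn f atTop S := by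
  rw [cauchySeq_iff_tendsto, (uniformity_basis_dist_le_frac _).tendsto_right_iff,
    UniformCauchySeqOn, prod_atTop_atTop_eq, Metric.uniformity_basis_dist_le.forall_iff
      fun _ _ hsub h => h.mono fun _ hm x hx => hsub (hm x hx)]
  refine forall₂_congr fun ε hε => eventually_congr (.of_forall fun m => ?_)
  exact dist_mkOn_le_frac_iff (hf := hf m.1) (hg := hf m.2) (𝒮.dense S hS) subset_rfl hε.le

theorem completeSpace_funRing
    (h𝒮 : ∀ S : ℕ → Set X, (∀ n, S n ∈ 𝒮.sets) → ⋂ n, S n ∈ 𝒮.sets) :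
    CompleteSpace 𝒮.FunRing := by
  refine Metric.complete_of_cauchySeq_tendsto fun u hu => ?_
  choose S hS f hf hfu using fun n => exists_eq_mkOn (u n)
  have hfc : ∀ n, ContinuousOn (f n) (⋂ n, S n) := fun n => (hf n).mono (iInter_subset S n)
  obtain rfl : u = fun n => mkOn _ (h𝒮 S hS) (f n) (hfc n) := funext fun n =>
    (hfu n).trans (mkOn_mono _ (iInter_subset S n) (hf n))
  have hcauchy : UniformCauchySeqOn f atTop (⋂ n, S n) := cauchySeq_mkOn_iff.1 hu
  have hlim : ∀ x ∈ ⋂ n, S n, ∃ y, Tendsto (fun n => f n x) atTop (𝓝 y) := fun x hx =>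
    cauchySeq_tendsto_of_complete (hcauchy.cauchySeq hx)
  choose! g hg using hlim
  have hunif : TendstoUniformlyOn f g atTop (⋂ n, S n) :=
    hcauchy.tendstoUniformlyOn_of_tendsto hg
  exact ⟨mkOn _ (h𝒮 S hS) g (hunif.continuousOn (Eventually.of_forall hfc).frequently),
    tendsto_mkOn_iff.2 hunif⟩

end UniformConvergence

end DenseFilterBase

section FunctionsOnDenseOpens

open DenseFilterBase

variable {X : Type u} [TopologicalSpace X] {𝒮 : DenseFilterBase X}

theorem exists_continuousMap_eq_one [CompletelyRegularSpace X] {K : Set X} (hK : IsClosed K)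
    {x : X} (hx : x ∉ K) : ∃ d : C(X, ℝ), d x = 1 ∧ EqOn d 0 K := by
  obtain ⟨g, hg, hgx, hgK⟩ := CompletelyRegularSpace.completely_regular x K hK hx
  exact ⟨⟨fun y => 1 - g y, by fun_prop⟩, by simp [hgx], fun y hy => by simp [hgK hy]⟩

/-- The points at which some function in the ideal `D` does not vanish. The quotients `φ d / d`,
where `φ` is a homomorphism defined on `D`, fit together to a function on this set. -/
def cozeroSet (D : Ideal C(X, ℝ)) : Set X := {x | ∃ d ∈ D, d x ≠ 0}

theorem isOpen_cozeroSet (D : Ideal C(X, ℝ)) : IsOpen (cozeroSet D) := by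
  simp only [cozeroSet, ← exists_prop, ofPred_exists]
  exact isOpen_iUnion fun d => isOpen_iUnion fun _ => isOpen_ne_fun d.continuous continuous_const

theorem IsDenseIdeal.dense_cozeroSet [CompletelyRegularSpace X] {D : Ideal C(X, ℝ)}
    (hD : IsDenseIdeal D) : Dense (cozeroSet D) := by
  by_contra! h
  obtain ⟨x, hx⟩ := not_forall.1 h
  obtain ⟨a, hax, ha⟩ := exists_continuousMap_eq_one isClosed_closure hx
  have ha0 : a = 0 := hD a fun d hd => by
    ext y
    by_cases hy : d y = 0
    · simp [hy]
    · simp [ha (subset_closure ⟨d, hd, hy⟩)]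
  simp [ha0] at hax

theorem algebraMap_funRing_injective (𝒮 : DenseFilterBase X) :
    Function.Injective (algebraMap C(X, ℝ) 𝒮.FunRing) := by
  intro f g h
  obtain ⟨S, hS⟩ := 𝒮.nonempty
  rw [algebraMap_eq_mkOn hS, algebraMap_eq_mkOn hS, mkOn_eq_iff (𝒮.dense S hS) Subset.rfl] at h
  exact DFunLike.coe_injective (f.continuous.ext_on (𝒮.dense S hS) g.continuous h)

theorem IsDenseIdeal.eq_zero_of_smul_eq_zero [CompletelyRegularSpace X] {D : Ideal C(X, ℝ)}
    (hD : IsDenseIdeal D) {b : 𝒮.FunRing} (hb : ∀ d ∈ D, d • b = 0) : b = 0 := by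
  obtain ⟨S, hS, f, hf, rfl⟩ := exists_eq_mkOn b
  have hdense : Dense (S ∩ cozeroSet D) :=
    (𝒮.dense S hS).inter_of_isOpen_right hD.dense_cozeroSet (isOpen_cozeroSet D)
  rw [← mkOn_zero hS, mkOn_eq_iff hdense inter_subset_left]
  rintro x ⟨hxS, d, hd, hdx⟩
  have hdf := hb d hd
  rw [smul_mkOn, ← mkOn_zero hS, mkOn_eq_iff (𝒮.dense S hS) Subset.rfl] at hdf
  exact (mul_eq_zero.1 (hdf hxS)).resolve_left hdx

theorem DenseHom.exists_mul_eq (φ : DenseHom C(X, ℝ)) :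
    ∃ f : X → ℝ, ∀ x ∈ cozeroSet φ.dom, ∀ d : φ.dom, d.1 x * f x = φ.hom d x := by
  have hquot : ∀ x, ∃ y : ℝ, x ∈ cozeroSet φ.dom → ∀ d : φ.dom, d.1 x * y = φ.hom d x := by
    intro x
    by_cases hx : x ∈ cozeroSet φ.dom
    · obtain ⟨c, hc, hcx⟩ := hx
      refine ⟨φ.hom ⟨c, hc⟩ x / c x, fun _ d => ?_⟩
      rw [← mul_div_assoc, div_eq_iff hcx, mul_comm (φ.hom d x)]
      exact DFunLike.congr_fun (φ.hom_mul_comm d.2 hc) x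
    · exact ⟨0, fun h => absurd h hx⟩
  exact ⟨_, fun x => (hquot x).choose_spec⟩

theorem continuousOn_cozeroSet {D : Ideal C(X, ℝ)} {φ : D → C(X, ℝ)} {f : X → ℝ}
    (hf : ∀ x ∈ cozeroSet D, ∀ d : D, d.1 x * f x = φ d x) : ContinuousOn f (cozeroSet D) := by
  rintro x ⟨d, hd, hdx⟩
  have hquot : ContinuousAt (fun y => φ ⟨d, hd⟩ y / d y) x :=
    (φ ⟨d, hd⟩).continuous.continuousAt.div d.continuous.continuousAt hdx
  refine (hquot.congr ?_).continuousWithinAt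
  filter_upwards [d.continuous.continuousAt.eventually_ne hdx] with y hy
  rw [div_eq_iff hy, mul_comm, hf y ⟨d, hd, hy⟩ ⟨d, hd⟩]

theorem DenseHom.exists_represents_funRing [CompletelyRegularSpace X]
    (h𝒮 : (denseOpens X).sets ⊆ 𝒮.sets) (φ : DenseHom C(X, ℝ)) :
    ∃ b : 𝒮.FunRing, φ.Represents b := by
  obtain ⟨f, hf⟩ := φ.exists_mul_eq
  have hcoz : cozeroSet φ.dom ∈ 𝒮.sets := h𝒮 ⟨isOpen_cozeroSet _, φ.dense.dense_cozeroSet⟩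
  refine ⟨mkOn _ hcoz f (continuousOn_cozeroSet hf), fun d => ?_⟩
  rw [smul_mkOn, algebraMap_eq_mkOn hcoz]
  exact mkOn_congr fun x hx => hf x hx d

theorem exists_continuousMap_eq_mul [CompletelyRegularSpace X] {V : Set X} (hV : IsOpen V)
    {f : X → ℝ} (hf : ContinuousOn f V) {x : X} (hx : x ∈ V) :
    ∃ d a : C(X, ℝ), d x = 1 ∧ ∀ y, a y = d y * f y := by
  obtain ⟨K, hKx, hK, hKV⟩ := exists_mem_nhds_isClosed_subset (hV.mem_nhds hx)
  obtain ⟨d, hdx, hd⟩ := exists_continuousMap_eq_one isOpen_interior.isClosed_compl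
    (notMem_compl_iff.2 (mem_interior_iff_mem_nhds.2 hKx))
  have hsupp : tsupport (fun y => d y * f y) ⊆ V := by
    refine (closure_minimal (fun y hy => ?_) hK).trans hKV
    by_contra hyK
    have hdy : d y = 0 := hd fun h => hyK (interior_subset h)
    exact hy (mul_eq_zero_of_left hdy _)
  exact ⟨d, ⟨_, (d.continuous.continuousOn.mul hf).continuous_of_tsupport_subset hV hsupp⟩,
    hdx, fun _ => rfl⟩

theorem isDenseIdeal_denominators [CompletelyRegularSpace X] (b : QFun X) :
    IsDenseIdeal (denominators C(X, ℝ) b) := by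
  intro c hc
  obtain ⟨V, hV, f, hf, rfl⟩ := exists_eq_mkOn b
  refine DFunLike.coe_injective (c.continuous.ext_on hV.2 continuous_const fun x hx => ?_)
  obtain ⟨d, a, hdx, ha⟩ := exists_continuousMap_eq_mul hV.1 hf hx
  have hd : d ∈ denominators C(X, ℝ) (mkOn V hV f hf) := by
    refine ⟨a, ?_⟩
    change algebraMap C(X, ℝ) (QFun X) a = d • mkOn V hV f hf
    rw [smul_mkOn, algebraMap_eq_mkOn hV]
    exact mkOn_congr fun y _ => ha y
  simpa [hdx] using DFunLike.congr_fun (hc d hd) x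

theorem isMaxQuot_QFun (X : Type u) [TopologicalSpace X] [CompletelyRegularSpace X] :
    IsMaxQuot C(X, ℝ) (QFun X) where
  injective_algebraMap := algebraMap_funRing_injective _
  eq_zero_of_smul_eq_zero _ hD _ hb := hD.eq_zero_of_smul_eq_zero hb
  exists_represents := DenseHom.exists_represents_funRing Subset.rfl
  isDenseIdeal_denominators := isDenseIdeal_denominators

end FunctionsOnDenseOpens

section FunctionsOnDenseSets

open Filter Uniformity

variable {Y : Type*} [TopologicalSpace Y] {E : Type*}

theorem isGδ_setOf_cauchy_map_nhdsWithin [UniformSpace E] [(𝓤 E).IsCountablyGenerated]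
    {A : Set Y} (hA : Dense A) (f : Y → E) : IsGδ {p | Cauchy (map f (𝓝[A] p))} := by
  obtain ⟨U, hU⟩ := (𝓤 E).exists_antitone_basis
  have hne : ∀ p, (𝓝[A] p).NeBot := fun p => mem_closure_iff_nhdsWithin_neBot.1 (hA p)
  simp only [cauchy_map_iff', (nhdsWithin_basis_open _ A).prod_self.tendsto_iff hU.toHasBasis,
    forall_prop_of_true, ofPred_forall]
  refine .iInter fun n => IsOpen.isGδ <| isOpen_iff_mem_nhds.2 ?_
  rintro p ⟨V, ⟨hpV, hV⟩, hVU⟩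
  filter_upwards [hV.mem_nhds hpV] with q hq using ⟨V, ⟨hq, hV⟩, hVU⟩

theorem exists_continuousOn_isGδ_eqOn [UniformSpace E] [(𝓤 E).IsCountablyGenerated]
    [CompleteSpace E] [T0Space E] {A : Set Y} (hA : Dense A) {f : Y → E}
    (hf : ContinuousOn f A) : ∃ G g, IsGδ G ∧ A ⊆ G ∧ ContinuousOn g G ∧ EqOn g f A := by
  refine ⟨_, extendFrom A f, isGδ_setOf_cauchy_map_nhdsWithin hA f, fun x hx => ?_,
    continuousOn_extendFrom (fun p _ => hA p) fun p hp => CompleteSpace.complete hp,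
    fun x hx => extendFrom_eq (hA x) (hf x hx)⟩
  have : (𝓝[A] x).NeBot := mem_closure_iff_nhdsWithin_neBot.1 (hA x)
  exact (hf x hx).cauchy_map

theorem exists_pairwise_disjoint_isOpen_subset {ι : Type*} {W : ι → Set Y}
    (hW : ∀ i, IsOpen (W i)) :
    ∃ V : ι → Set Y, (∀ i, IsOpen (V i)) ∧ (∀ i, V i ⊆ W i) ∧
      Pairwise (Function.onFun Disjoint V) ∧ ⋃ i, W i ⊆ closure (⋃ i, V i) := by
  obtain ⟨_, hwf⟩ := exists_wellFoundedLT ι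
  refine ⟨fun i => W i \ closure (⋃ j < i, W j), fun i => (hW i).sdiff isClosed_closure,
    fun i => sdiff_subset, ?_, ?_⟩
  · refine (pairwise_disjoint_on _).2 fun i j hij => disjoint_left.2 fun x hxi hxj => ?_
    exact hxj.2 (subset_closure (mem_biUnion hij hxi.1))
  · intro x hx
    refine mem_closure_iff.2 fun U hU hxU => ?_
    have hmeet : {i | (U ∩ W i).Nonempty}.Nonempty :=
      (mem_iUnion.1 hx).imp fun i hxi => ⟨x, hxU, hxi⟩
    obtain ⟨i, ⟨y, hyU, hyi⟩, hmin⟩ := hwf.wf.has_min _ hmeet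
    have hdisj : Disjoint U (⋃ j < i, W j) := disjoint_iUnion₂_right.2 fun j hj =>
      disjoint_iff_inter_eq_empty.2 (not_nonempty_iff_eq_empty.1 fun hne => hmin j hne hj)
    exact ⟨y, hyU, mem_iUnion.2 ⟨i, hyi, disjoint_left.1 (hdisj.closure_right hU) hyU⟩⟩

theorem exists_continuousOn_isOpen_dist_lt [PseudoMetricSpace E] {S : Set Y} (hS : Dense S)
    {g : Y → E} (hg : ContinuousOn g S) {δ : ℝ} (hδ : 0 < δ) :
    ∃ O F, IsOpen O ∧ Dense O ∧ ContinuousOn F O ∧ ∀ x ∈ S ∩ O, dist (g x) (F x) < δ := by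
  choose W hW hWS using fun c =>
    continuousOn_iff'.1 hg (Metric.ball c δ) Metric.isOpen_ball
  obtain ⟨V, hV, hVW, hdisj, hWV⟩ := exists_pairwise_disjoint_isOpen_subset hW
  have hconst : ∀ x, ∃ y, ∀ c, x ∈ V c → y = c := by
    intro x
    by_cases hx : ∃ c, x ∈ V c
    · exact hx.imp fun c hc c' hc' => hdisj.eq (not_disjoint_iff.2 ⟨x, hc, hc'⟩)
    · exact ⟨g x, fun c hc => absurd ⟨c, hc⟩ hx⟩
  choose F hF using hconst
  have hSW : S ⊆ ⋃ c, W c := fun x hx =>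
    mem_iUnion.2 ⟨g x, ((hWS (g x)).subset ⟨Metric.mem_ball_self hδ, hx⟩).1⟩
  refine ⟨⋃ c, V c, F, isOpen_iUnion hV, (hS.mono (hSW.trans hWV)).of_closure,
    ContinuousOn.iUnion_of_isOpen (fun c => continuousOn_const.congr fun x => hF x c) hV, ?_⟩
  rintro x ⟨hxS, hx⟩
  obtain ⟨c, hc⟩ := mem_iUnion.1 hx
  rw [hF x c hc]
  exact ((hWS c).superset ⟨hVW c hc, hxS⟩).1

end FunctionsOnDenseSets

section Extension

open DenseFilterBase

variable {X : Type u} [TopologicalSpace X] {Y : Type*} [TopologicalSpace Y] {j : X → Y}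
  {𝒮 : DenseFilterBase X} {𝒯 : DenseFilterBase Y} {a a' : 𝒮.FunRing} {b b' : 𝒯.FunRing}

/-- The element `b` of `C[𝒯]` extends the element `a` of `C[𝒮]` along `j`: there is a function `g`
such that `b` is represented by `g` and `a` by `g ∘ j`, on domains that `j` maps into each other. -/
def Extends (j : X → Y) (a : 𝒮.FunRing) (b : 𝒯.FunRing) : Prop :=
  ∃ S hS T hT g hgj hg, MapsTo j S T ∧ a = mkOn S hS (g ∘ j) hgj ∧ b = mkOn T hT g hg

namespace Extends

theorem exists_common (h : Extends j a b) (h' : Extends j a' b') :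
    ∃ S hS T hT g g' hgj hgj' hg hg', MapsTo j S T ∧
      a = mkOn S hS (g ∘ j) hgj ∧ a' = mkOn S hS (g' ∘ j) hgj' ∧
      b = mkOn T hT g hg ∧ b' = mkOn T hT g' hg' := by
  obtain ⟨S, hS, T, hT, g, hgj, hg, hST, rfl, rfl⟩ := h
  obtain ⟨S', hS', T', hT', g', hgj', hg', hST', rfl, rfl⟩ := h'
  exact ⟨S ∩ S', 𝒮.inter S hS S' hS', T ∩ T', 𝒯.inter T hT T' hT', g, g',
    hgj.mono inter_subset_left, hgj'.mono inter_subset_right, hg.mono inter_subset_left,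
    hg'.mono inter_subset_right, hST.inter_inter hST', mkOn_mono _ inter_subset_left _,
    mkOn_mono _ inter_subset_right _, mkOn_mono _ inter_subset_left _,
    mkOn_mono _ inter_subset_right _⟩

theorem add (h : Extends j a b) (h' : Extends j a' b') : Extends j (a + a') (b + b') := by
  obtain ⟨S, hS, T, hT, g, g', hgj, hgj', hg, hg', hST, rfl, rfl, rfl, rfl⟩ := h.exists_common h'
  exact ⟨S, hS, T, hT, fun y => g y + g' y, hgj.add hgj', hg.add hg', hST, mkOn_add _ _,
    mkOn_add _ _⟩

theorem mul (h : Extends j a b) (h' : Extends j a' b') : Extends j (a * a') (b * b') := by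
  obtain ⟨S, hS, T, hT, g, g', hgj, hgj', hg, hg', hST, rfl, rfl, rfl, rfl⟩ := h.exists_common h'
  exact ⟨S, hS, T, hT, fun y => g y * g' y, hgj.mul hgj', hg.mul hg', hST, mkOn_mul _ _,
    mkOn_mul _ _⟩

theorem one (h𝒯 : univ ∈ 𝒯.sets) : Extends j (1 : 𝒮.FunRing) (1 : 𝒯.FunRing) := by
  obtain ⟨S, hS⟩ := 𝒮.nonempty
  exact ⟨S, hS, univ, h𝒯, fun _ => 1, _, _, mapsTo_univ j S, (mkOn_one hS).symm,
    (mkOn_one h𝒯).symm⟩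

theorem zero (h𝒯 : univ ∈ 𝒯.sets) : Extends j (0 : 𝒮.FunRing) (0 : 𝒯.FunRing) := by
  obtain ⟨S, hS⟩ := 𝒮.nonempty
  exact ⟨S, hS, univ, h𝒯, fun _ => 0, _, _, mapsTo_univ j S, (mkOn_zero hS).symm,
    (mkOn_zero h𝒯).symm⟩

theorem dist_eq (hj : IsDenseInducing j) (h : Extends j a b) (h' : Extends j a' b') :
    dist b b' = dist a a' := by
  obtain ⟨S, hS, T, hT, g, g', hgj, hgj', hg, hg', hST, rfl, rfl, rfl, rfl⟩ := h.exists_common h'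
  refine eq_of_forall_ge_iff fun c => ?_
  rcases lt_or_ge c 0 with hc | hc
  · simp only [(hc.trans_le dist_nonneg).not_ge]
  · rw [dist_mkOn_le_iff (𝒮.dense S hS) subset_rfl hc,
      dist_mkOn_le_iff (hj.dense_image.2 (𝒮.dense S hS)) hST.image_subset hc, forall_mem_image]
    rfl

theorem unique (hj : IsDenseInducing j) (h : Extends j a b) (h' : Extends j a b') : b = b' :=
  dist_eq_zero.1 ((h.dist_eq hj h').trans (dist_self a))

end Extends

theorem exists_extends [BaireSpace Y] (hj : IsDenseEmbedding j)
    (h𝒯 : (denseGδs Y).sets ⊆ 𝒯.sets) (a : 𝒮.FunRing) : ∃ b : 𝒯.FunRing, Extends j a b := by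
  obtain ⟨S, hS, f, hf, rfl⟩ := exists_eq_mkOn a
  obtain ⟨F, rfl⟩ : ∃ F : Y → ℝ, F ∘ j = f := ⟨_, Function.extend_comp hj.injective f 0⟩
  have hF : ContinuousOn F (j '' S) := by
    rintro _ ⟨x, hx, rfl⟩
    rw [ContinuousWithinAt, ← hj.isInducing.map_nhdsWithin_eq, Filter.tendsto_map'_iff]
    exact hf x hx
  have hdense : Dense (j '' S) := hj.dense_image.2 (𝒮.dense S hS)
  obtain ⟨G, g, hG, hSG, hg, hgF⟩ := exists_continuousOn_isGδ_eqOn hdense hF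
  have hgj : EqOn (F ∘ j) (g ∘ j) S := fun x hx => (hgF (mem_image_of_mem j hx)).symm
  exact ⟨mkOn G (h𝒯 ⟨hG, hdense.mono hSG⟩) g hg, S, hS, G, _, g, hf.congr hgj.symm, hg,
    mapsTo_iff_image_subset.2 hSG, mkOn_congr hgj, rfl⟩

/-- The ring homomorphism extending functions along a dense embedding. -/
def extensionHom [BaireSpace Y] (hj : IsDenseEmbedding j) (h𝒯 : (denseGδs Y).sets ⊆ 𝒯.sets) :
    𝒮.FunRing →+* 𝒯.FunRing where
  toFun a := (exists_extends hj h𝒯 a).choose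
  map_one' := (exists_extends hj h𝒯 1).choose_spec.unique hj.isDenseInducing
    (.one (h𝒯 ⟨.univ, dense_univ⟩))
  map_zero' := (exists_extends hj h𝒯 0).choose_spec.unique hj.isDenseInducing
    (.zero (h𝒯 ⟨.univ, dense_univ⟩))
  map_add' a b := (exists_extends hj h𝒯 (a + b)).choose_spec.unique hj.isDenseInducing
    ((exists_extends hj h𝒯 a).choose_spec.add (exists_extends hj h𝒯 b).choose_spec)
  map_mul' a b := (exists_extends hj h𝒯 (a * b)).choose_spec.unique hj.isDenseInducing
    ((exists_extends hj h𝒯 a).choose_spec.mul (exists_extends hj h𝒯 b).choose_spec)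

theorem preimage_mem_denseOpens (hj : IsDenseEmbedding j) {O : Set Y}
    (hO : O ∈ (denseOpens Y).sets) : j ⁻¹' O ∈ (denseOpens X).sets := by
  refine ⟨hO.1.preimage hj.continuous, hj.dense_image.1 ?_⟩
  rw [image_preimage_eq_inter_range]
  exact hO.2.inter_of_isOpen_left hj.dense hO.1

section ExtensionHom

variable [BaireSpace Y] (hj : IsDenseEmbedding j) (h𝒯 : (denseGδs Y).sets ⊆ 𝒯.sets)

theorem extends_extensionHom (a : 𝒮.FunRing) : Extends j a (extensionHom hj h𝒯 a) :=
  (exists_extends hj h𝒯 a).choose_spec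

theorem isometry_extensionHom : Isometry (extensionHom (𝒮 := 𝒮) hj h𝒯) :=
  .of_dist_eq fun a b => (extends_extensionHom hj h𝒯 a).dist_eq hj.isDenseInducing
    (extends_extensionHom hj h𝒯 b)

theorem mkOn_mem_range_extensionHom (h𝒮 : (denseOpens X).sets ⊆ 𝒮.sets) {O : Set Y}
    (hO : O ∈ (denseOpens Y).sets) {hO' : O ∈ 𝒯.sets} {F : Y → ℝ} {hF : ContinuousOn F O} :
    mkOn O hO' F hF ∈ (extensionHom (𝒮 := 𝒮) hj h𝒯).range := by
  let a : 𝒮.FunRing := mkOn (j ⁻¹' O) (h𝒮 (preimage_mem_denseOpens hj hO)) (F ∘ j)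
    (hF.comp hj.continuous.continuousOn (mapsTo_preimage j O))
  have ha : Extends j a (mkOn O hO' F hF) :=
    ⟨_, _, O, hO', F, _, hF, mapsTo_preimage j O, rfl, rfl⟩
  exact ⟨a, (extends_extensionHom hj h𝒯 a).unique hj.isDenseInducing ha⟩

theorem mem_range_extensionHom_of_isIdempotentElem (h𝒮 : (denseOpens X).sets ⊆ 𝒮.sets)
    {b : 𝒯.FunRing} (hb : IsIdempotentElem b) : b ∈ (extensionHom (𝒮 := 𝒮) hj h𝒯).range := by
  obtain ⟨U, hU, rfl⟩ :=
    exists_eq_indicator_of_isIdempotentElem (fun O hO => h𝒯 ⟨hO.1.isGδ, hO.2⟩) hb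
  exact mkOn_mem_range_extensionHom hj h𝒯 h𝒮 (compl_frontier_mem_denseOpens hU)

theorem denseRange_extensionHom (h𝒮 : (denseOpens X).sets ⊆ 𝒮.sets) :
    DenseRange (extensionHom (𝒮 := 𝒮) hj h𝒯) := by
  refine Metric.denseRange_iff.2 fun b ε hε => ?_
  obtain ⟨S, hS, g, hg, rfl⟩ := exists_eq_mkOn b
  obtain ⟨O, F, hO, hOd, hF, hgF⟩ := exists_continuousOn_isOpen_dist_lt (𝒯.dense S hS) hg hε
  have hO𝒯 : O ∈ 𝒯.sets := h𝒯 ⟨hO.isGδ, hOd⟩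
  have hSO := 𝒯.inter S hS O hO𝒯
  obtain ⟨a, ha⟩ : mkOn O hO𝒯 F hF ∈ (extensionHom (𝒮 := 𝒮) hj h𝒯).range :=
    mkOn_mem_range_extensionHom hj h𝒯 h𝒮 ⟨hO, hOd⟩
  refine ⟨a, lt_of_le_of_lt ?_ (div_lt_self hε (lt_add_of_pos_right 1 hε))⟩
  rw [ha, mkOn_mono hSO inter_subset_left hg, mkOn_mono hSO inter_subset_right hF,
    dist_mkOn_le_frac_iff (𝒯.dense _ hSO) subset_rfl hε.le]
  exact fun x hx => (hgF x hx).le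

/-- A dense embedding `j` into a Baire space induces a homeomorphism of the maximal ideal spaces of
the two rings of functions, as idempotents extend and restrict along `j`. -/
def homeomorphMaximalSpectrumExtension (h𝒮 : (denseOpens X).sets ⊆ 𝒮.sets) :
    MaximalSpectrum 𝒮.FunRing ≃ₜ MaximalSpectrum 𝒯.FunRing :=
  (isExchangeRing h𝒮).homeomorphOfRingHom (isExchangeRing fun _ hO => h𝒯 ⟨hO.1.isGδ, hO.2⟩)
    (extensionHom hj h𝒯) (isometry_extensionHom hj h𝒯).injective
    fun _ => mem_range_extensionHom_of_isIdempotentElem hj h𝒯 h𝒮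

end ExtensionHom

theorem denseGδs_iInter_mem [BaireSpace Y] {S : ℕ → Set Y}
    (hS : ∀ n, S n ∈ (denseGδs Y).sets) : ⋂ n, S n ∈ (denseGδs Y).sets :=
  ⟨.iInter fun n => (hS n).1, dense_iInter_of_Gδ (fun n => (hS n).1) fun n => (hS n).2⟩

end Extension

end RingsOfQuotients

end

open RingsOfQuotients in
theorem mainTheorem8_general (X : Type*) [TopologicalSpace X] [CompletelyRegularSpace X]
    {Y : Type*} [TopologicalSpace Y] [BaireSpace Y] {j : X → Y} (hj : IsDenseEmbedding j) :
    Nonempty (Q X ≃ₐ[C(X, ℝ)] QFun X) ∧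
    (CompleteSpace (denseGδs Y).FunRing ∧
      ∃ ι : QFun X →+* (denseGδs Y).FunRing, Isometry ι ∧ DenseRange ι) ∧
    Nonempty (MaximalSpectrum (Q X) ≃ₜ MaximalSpectrum (QStar X)) ∧
    Nonempty (MaximalSpectrum (Q X) ≃ₜ MaximalSpectrum (denseGδs Y).FunRing) ∧
    Nonempty (MaximalSpectrum (Q X) ≃ₜ MaximalSpectrum (denseGδs Y).bounded) ∧
    Nonempty (MaximalSpectrum (Q X) ≃ₜ MaximalSpectrum (IdempotentRing (Q X))) := by
  let ψ := (isMaxQuot_QFun X).algEquiv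
  have hGδ : (denseOpens Y).sets ⊆ (denseGδs Y).sets := fun O hO => ⟨hO.1.isGδ, hO.2⟩
  have hQFun : IsExchangeRing (QFun X) := DenseFilterBase.isExchangeRing Subset.rfl
  have hQ : IsExchangeRing (Q X) := hQFun.of_ringEquiv ψ.toRingEquiv
  let toQFun : MaximalSpectrum (Q X) ≃ₜ MaximalSpectrum (QFun X) :=
    hQ.homeomorphOfRingHom hQFun (ψ : Q X →+* QFun X) ψ.injective fun a _ => ψ.surjective a
  let toExtension : MaximalSpectrum (Q X) ≃ₜ MaximalSpectrum (denseGδs Y).FunRing :=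
    toQFun.trans (homeomorphMaximalSpectrumExtension hj Subset.rfl Subset.rfl)
  exact ⟨⟨ψ⟩,
    ⟨DenseFilterBase.completeSpace_funRing fun S hS => denseGδs_iInter_mem hS,
      extensionHom hj Subset.rfl, isometry_extensionHom hj Subset.rfl,
      denseRange_extensionHom hj Subset.rfl Subset.rfl⟩,
    ⟨toQFun.trans (DenseFilterBase.homeomorphMaximalSpectrumBounded Subset.rfl).symm⟩,
    ⟨toExtension⟩,
    ⟨toExtension.trans (DenseFilterBase.homeomorphMaximalSpectrumBounded hGδ).symm⟩,
    ⟨hQ.homeomorphIdempotentRing (RingHom.id (Q X)) Function.injective_id fun a _ => ⟨a, rfl⟩⟩⟩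

theorem mainTheorem8 (X : Type*) [TopologicalSpace X] [T35Space X] :
    -- `QFun X` is the maximal ring of quotients of `C(X)`
    Nonempty (RingsOfQuotients.Q X ≃ₐ[C(X, ℝ)] RingsOfQuotients.QFun X) ∧
    -- `QBar X` is the metric completion of `QFun X`
    (CompleteSpace (RingsOfQuotients.QBar X) ∧
      ∃ ι : RingsOfQuotients.QFun X →+* RingsOfQuotients.QBar X, Isometry ι ∧ DenseRange ι) ∧
    -- the maximal ideal spaces are homeomorphic
    Nonempty (MaximalSpectrum (RingsOfQuotients.Q X) ≃ₜ
      MaximalSpectrum (RingsOfQuotients.QStar X)) ∧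
    Nonempty (MaximalSpectrum (RingsOfQuotients.Q X) ≃ₜ
      MaximalSpectrum (RingsOfQuotients.QBar X)) ∧
    Nonempty (MaximalSpectrum (RingsOfQuotients.Q X) ≃ₜ
      MaximalSpectrum (RingsOfQuotients.QBarStar X)) ∧
    Nonempty (MaximalSpectrum (RingsOfQuotients.Q X) ≃ₜ
      MaximalSpectrum (RingsOfQuotients.IdempotentRing (RingsOfQuotients.Q X))) :=
  mainTheorem8_general X isDenseEmbedding_stoneCechUnit
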